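/- Let $f_1,\dots,f_N:\mathbb R^n\to\mathbb R^n$ be locally Lipschitz with $f_i(0)=0$, and let $\mathcal P=\{1,\dots,N\}$. Let $\sigma=(\sigma(t))_{t\ge 0}$ be a measurable càdlàg process on a probability space $(\Omega,\mathfrak F,\mathsf P)$ with values in $\mathcal P$ and deterministic $\sigma(0)=\sigma_0$. Let $0=\tau_0<\tau_1<\tau_2<\cdots$ be its (random) switching instants: almost surely, $\sigma$ is constant on each $[\tau_j,\tau_{j+1})$, and the value chosen at a switching instant is allowed to coincide with the previous one. Consider the randomly switched system $$\dot x(t)=f_{\sigma(t)}(x(t)),\qquad x(0)=x_0\in\mathbb R^n,\qquad t\ge 0,$$ whose solutions are understood in the sense of Carathéodory (locally absolutely continuous paths satisfying the equation for almost every $t$). Assume the following. (E1) There are $C^1$ functions $V_i:\mathbb R^n\to\mathbb R$, functions $\alpha_1,\alpha_2:[0,\infty)\to[0,\infty)$ of class $\mathcal K_\infty$ (continuous, strictly increasing, unbounded, vanishing at $0$), and numbers $\mu>1$, $\lambda_i\in\mathbb R$ ($i\in\mathcal P$) such that for all $x\in\mathbb R^n$ and $i,j\in\mathcal P$ $$\alpha_1(\|x\|)\le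 V_i(x)\le\alpha_2(\|x\|),\qquad \langle\nabla V_i(x),f_i(x)\rangle\le-\lambda_iV_i(x),\qquad V_i(x)\le\mu V_j(x).$$ (E2) The holding times $S_i=\tau_i-\tau_{i-1}$, $i\ge 1$, are independent and exponentially distributed with parameter $\lambda>0$; there are $q_i\in[0,1]$ with $\mathsf P\bigl(\sigma(\tau_j)=i\mid\sigma(\tau_0),\dots,\sigma(\tau_{j-1})\bigr)=q_i$ almost surely for all $j\ge1$, $i\in\mathcal P$; and the sequences $(S_i)_{i\ge1}$ and $(\sigma(\tau_j))_{j\ge0}$ are independent. (E3) $\lambda_i+\lambda>0$ for all $i\in\mathcal P$. (E4) $\displaystyle\sum_{i\in\mathcal P}\frac{\mu q_i}{1+\lambda_i/\lambda}<1$. Then, for almost every sample path of $\sigma$, for every $x_0$ the system has a unique global solution on $[0,\infty)$. Each state $x(t)$ is a random variable (measurable up to a null set), and the system is $\alpha_1$-globally asymptotically stable in the mean: (SM1) for every $\varepsilon>0$ there is $\tilde\delta>0$ such that $\|x_0\|<\tilde\delta$ implies $\sup_{t\ge0}\mathsf E[\alpha_1(\|x(t)\|)]<\varepsilon$; (SM2)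 for all $r,\varepsilon'>0$ there is $\tilde T\ge0$ such that $\|x_0\|<r$ implies $\sup_{t\ge\tilde T}\mathsf E[\alpha_1(\|x(t)\|)]<\varepsilon'$. -/

import Mathlib

open MeasureTheory ProbabilityTheory Filter Set
open scoped NNReal ENNReal Topology

namespace SwitchedSystem

/-- Class `𝒦`: continuous strictly increasing functions `[0, ∞) → [0, ∞)` vanishing at `0`. -/
structure IsClassK (α : ℝ≥0 → ℝ≥0) : Prop where
  continuous : Continuous α
  strictMono : StrictMono α
  map_zero : α 0 = 0

/-- Class `𝒦_∞`: unbounded functions of class `𝒦`. -/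
structure IsClassKInfty (α : ℝ≥0 → ℝ≥0) : Prop extends IsClassK α where
  tendsto_atTop : Tendsto α atTop atTop

/-- The Lie derivative `⟨∇V(x), g(x)⟩` of `V` along the vector field `g`. -/
noncomputable def lieDeriv {n : ℕ}
    (g : EuclideanSpace ℝ (Fin n) → EuclideanSpace ℝ (Fin n))
    (V : EuclideanSpace ℝ (Fin n) → ℝ) (x : EuclideanSpace ℝ (Fin n)) : ℝ :=
  inner ℝ (gradient V x) (g x)

/-- The family `f` of vector fields is locally Lipschitz and vanishes at the origin. -/
structure IsSubsystemFamily {n N : ℕ}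
    (f : Fin N → EuclideanSpace ℝ (Fin n) → EuclideanSpace ℝ (Fin n)) : Prop where
  locallyLipschitz : ∀ i, LocallyLipschitz (f i)
  map_zero : ∀ i, f i 0 = 0

/-- `V` is a family of Lyapunov-like functions for the family `f`, with bounds `α₁, α₂`,
jump ratio `μ` and (possibly negative) decay rates `lam i`. -/
structure IsLyapunovFamily {n N : ℕ}
    (f : Fin N → EuclideanSpace ℝ (Fin n) → EuclideanSpace ℝ (Fin n))
    (V : Fin N → EuclideanSpace ℝ (Fin n) → ℝ) (α₁ α₂ : ℝ≥0 → ℝ≥0)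
    (μ : ℝ) (lam : Fin N → ℝ) : Prop where
  contDiff : ∀ i, ContDiff ℝ 1 (V i)
  classKInfty_lower : IsClassKInfty α₁
  classKInfty_upper : IsClassKInfty α₂
  one_lt : 1 < μ
  lower_bound : ∀ i x, (α₁ ‖x‖₊ : ℝ) ≤ V i x
  upper_bound : ∀ i x, V i x ≤ (α₂ ‖x‖₊ : ℝ)
  lieDeriv_le : ∀ i x, lieDeriv (f i) (V i) x ≤ -lam i * V i x
  le_mul : ∀ i j x, V i x ≤ μ * V j x

/-- A path `[0, ∞) → Fin N` which is right-continuous and has left limits, for the discrete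
topology (only the values at nonnegative times are constrained). -/
def IsCadlagPath {N : ℕ} (s : ℝ → Fin N) : Prop :=
  (∀ t, 0 ≤ t → ∀ᶠ u in 𝓝[>] t, s u = s t) ∧
    ∀ t, 0 < t → ∃ i, ∀ᶠ u in 𝓝[<] t, s u = i

/-- `σ` is a switching signal, i.e. a measurable càdlàg process in `Fin N` indexed by `[0, ∞)`,
with deterministic initial value `σ₀` and switching instants `0 = τ 0 < τ 1 < τ 2 < ⋯`.
Almost surely `σ` is constant on each `[τ j, τ (j + 1))`; the value chosen at a switching instant
may coincide with the preceding one. Times are real numbers, and nothing is required of `σ` at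
negative times. -/
structure IsSwitchingSignal {Ω : Type*} [MeasurableSpace Ω] (P : Measure Ω) {N : ℕ}
    (σ : ℝ → Ω → Fin N) (σ₀ : Fin N) (τ : ℕ → Ω → ℝ) : Prop where
  measurable : Measurable fun p : ℝ≥0 × Ω => σ (p.1 : ℝ) p.2
  cadlag : ∀ ω, IsCadlagPath fun t => σ t ω
  initial : ∀ ω, σ 0 ω = σ₀
  measurable_instant : ∀ j, Measurable (τ j)
  instant_zero : ∀ ω, τ 0 ω = 0
  strictMono : ∀ᵐ ω ∂P, StrictMono fun j => τ j ω
  const_between : ∀ᵐ ω ∂P, ∀ j, ∀ t ∈ Ico (τ j ω) (τ (j + 1) ω), σ t ω = σ (τ j ω) ω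

/-- The holding times `τ (i + 1) - τ i`. -/
def holdingTime {Ω : Type*} (τ : ℕ → Ω → ℝ) (i : ℕ) (ω : Ω) : ℝ :=
  τ (i + 1) ω - τ i ω

/-- The values of the signal at the switching instants. -/
def modeAt {Ω : Type*} {N : ℕ} (σ : ℝ → Ω → Fin N) (τ : ℕ → Ω → ℝ) (j : ℕ) (ω : Ω) : Fin N :=
  σ (τ j ω) ω

/-- Class EH: the holding times are i.i.d. exponential with parameter `rate > 0`; for every
`j ≥ 1`, conditionally on the modes at the instants `τ 0, …, τ (j - 1)`, the mode at `τ j` equals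
`i` with probability `q i`; and the sequence of holding times is independent of the sequence of
modes. -/
structure IsClassEH {Ω : Type*} [MeasurableSpace Ω] (P : Measure Ω) {N : ℕ}
    (σ : ℝ → Ω → Fin N) (τ : ℕ → Ω → ℝ) (rate : ℝ) (q : Fin N → ℝ) : Prop where
  rate_pos : 0 < rate
  holding_indep : iIndepFun (holdingTime τ) P
  holding_law : ∀ i, HasLaw (holdingTime τ i) (expMeasure rate) P
  prob_mem : ∀ i, q i ∈ Icc (0 : ℝ) 1
  mode_condProb : ∀ j, 1 ≤ j → ∀ i,
    P⟦{ω | modeAt σ τ j ω = i} |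
      MeasurableSpace.comap (fun ω (k : Fin j) => modeAt σ τ k ω) inferInstance⟧
      =ᵐ[P] fun _ => q i
  indep : IndepFun (fun ω i => holdingTime τ i ω) (fun ω j => modeAt σ τ j ω) P

/-- `x` is a (global, forward) Carathéodory solution of `x' = f_{s(t)}(x)`, `x(0) = x₀`, along the
switching path `s`: it is absolutely continuous on every `[0, T]` and satisfies the equation at
almost every `t > 0`. -/
structure IsSolution {n N : ℕ}
    (f : Fin N → EuclideanSpace ℝ (Fin n) → EuclideanSpace ℝ (Fin n)) (s : ℝ → Fin N)
    (x₀ : EuclideanSpace ℝ (Fin n)) (x : ℝ → EuclideanSpace ℝ (Fin n)) : Prop where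
  initial : x 0 = x₀
  absolutelyContinuous : ∀ T, 0 ≤ T → AbsolutelyContinuousOnInterval x 0 T
  hasDerivAt : ∀ᵐ t : ℝ, 0 < t → HasDerivAt x (f (s t) (x t)) t

/-- For almost every sample path of `σ`, every initial state has exactly one global solution
(unique on `[0, ∞)`). -/
def HasUniqueGlobalSolutions {Ω : Type*} [MeasurableSpace Ω] (P : Measure Ω) {n N : ℕ}
    (f : Fin N → EuclideanSpace ℝ (Fin n) → EuclideanSpace ℝ (Fin n))
    (σ : ℝ → Ω → Fin N) : Prop :=
  ∀ᵐ ω ∂P, ∀ x₀, ∃ x, IsSolution f (fun t => σ t ω) x₀ x ∧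
    ∀ y, IsSolution f (fun t => σ t ω) x₀ y → EqOn y x (Ici 0)

/-- `X x₀ t ω` is the solution process of the switched system: for each initial state `x₀`, almost
every path `X x₀ · ω` is the solution starting at `x₀`. -/
def IsSolutionProcess {Ω : Type*} [MeasurableSpace Ω] (P : Measure Ω) {n N : ℕ}
    (f : Fin N → EuclideanSpace ℝ (Fin n) → EuclideanSpace ℝ (Fin n)) (σ : ℝ → Ω → Fin N)
    (X : EuclideanSpace ℝ (Fin n) → ℝ → Ω → EuclideanSpace ℝ (Fin n)) : Prop :=
  ∀ x₀, ∀ᵐ ω ∂P, IsSolution f (fun t => σ t ω) x₀ fun t => X x₀ t ω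

/-- `α`-global asymptotic stability in the mean of a process `X x₀ t ω` depending on an initial
state. The states are random variables, and the expectations of the nonnegative variables
`α(‖X x₀ t‖)` are taken in `[0, ∞]`. -/
structure IsGASMean {Ω : Type*} [MeasurableSpace Ω] (P : Measure Ω) {n : ℕ} (α : ℝ≥0 → ℝ≥0)
    (X : EuclideanSpace ℝ (Fin n) → ℝ → Ω → EuclideanSpace ℝ (Fin n)) : Prop where
  aemeasurable : ∀ x₀ t, 0 ≤ t → AEMeasurable (X x₀ t) P
  stable : ∀ ε : ℝ, 0 < ε → ∃ δ : ℝ, 0 < δ ∧ ∀ x₀, ‖x₀‖ < δ →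
    (⨆ t ∈ Ici (0 : ℝ), ∫⁻ ω, (α ‖X x₀ t ω‖₊ : ℝ≥0∞) ∂P) < ENNReal.ofReal ε
  attractive : ∀ r ε : ℝ, 0 < r → 0 < ε → ∃ T : ℝ, 0 ≤ T ∧ ∀ x₀, ‖x₀‖ < r →
    (⨆ t ∈ Ici T, ∫⁻ ω, (α ‖X x₀ t ω‖₊ : ℝ≥0∞) ∂P) < ENNReal.ofReal ε

end SwitchedSystem

namespace SwitchedSystem

/-! ### Vector fields on Euclidean space -/

section Fields

variable {n : ℕ}

/-! While mode `i` is active, the Lie derivative bound and Gronwall's inequality multiply `V i` by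
at most `exp (-lam i * s)` in time `s`, and each switch costs a factor `μ`. So on the event that
exactly `j` switches occur up to time `t`, `α₁ ‖x t‖` is at most `α₂ ‖x₀‖` times `μ ^ j` and a
product of exponentials in the holding times (`IsSwitchingPath.lyapunov_le`). For `β > 0` the factor
`exp (-β * t)` can be extracted, because the elapsed times add up to `t`; this replaces each
exponent `-lam i` by `β - lam i`.

Now take expectations. With the modes frozen, the complete holding times contribute Laplace
transforms `rate / (rate - (β - lam i))`, while the incomplete last one contributes at most `1`
(`lintegral_switchWeight_le`). Averaging over the modes gives powers of `∑ i, q i * (rate / (rate -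
(β - lam i)))` (`lintegral_prod_modes`). Summed over `j`, the bounds form a geometric series, whose
ratio is below `1` for small `β` by (E4) (`exists_decay_rate`). Hence the mean of `α₁ ‖x t‖` is at
most `K * exp (-β * t) * α₂ ‖x₀‖` (`exists_mean_decay`), which contains both stability and
attractivity.

Global solutions exist because the Lyapunov bounds exclude blow-up within a mode and the switching
instants tend to infinity almost surely; they are obtained by concatenating the flows of the modes.
The same concatenation, with random times and modes inserted, yields measurability. -/

theorem exists_lipschitzOnWith_closedBall
    {g : EuclideanSpace ℝ (Fin n) → EuclideanSpace ℝ (Fin n)} (hg : LocallyLipschitz g) (R : ℝ) :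
    ∃ K, LipschitzOnWith K g (Metric.closedBall 0 R) :=
  LocallyLipschitzOn.exists_lipschitzOnWith_of_compact (isCompact_closedBall _ _)
    hg.locallyLipschitzOn

/-- Coordinatewise truncation to the box `[-R, R]ⁿ`. -/
noncomputable def clamp (R : ℝ) (x : EuclideanSpace ℝ (Fin n)) : EuclideanSpace ℝ (Fin n) :=
  WithLp.toLp 2 fun i => max (-R) (min R (x i))

theorem lipschitzWith_clamp (R : ℝ) : LipschitzWith 1 (clamp (n := n) R) := by
  refine LipschitzWith.of_dist_le_mul fun x y => ?_
  rw [NNReal.coe_one, one_mul, EuclideanSpace.dist_eq, EuclideanSpace.dist_eq]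
  refine Real.sqrt_le_sqrt (Finset.sum_le_sum fun i _ => ?_)
  refine pow_le_pow_left₀ dist_nonneg ?_ 2
  simp only [clamp, Real.dist_eq]
  refine (abs_max_sub_max_le_max (-R) _ (-R) _).trans (max_le (by simp) ?_)
  exact (abs_min_sub_min_le_max R (x i) R (y i)).trans (max_le (by simp) le_rfl)

theorem norm_clamp_le {R : ℝ} (hR : 0 ≤ R) (x : EuclideanSpace ℝ (Fin n)) :
    ‖clamp R x‖ ≤ √(n * R ^ 2) := by
  rw [EuclideanSpace.norm_eq]
  refine Real.sqrt_le_sqrt ?_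
  refine (Finset.sum_le_card_nsmul _ _ (R ^ 2) fun i _ => ?_).trans (by simp)
  refine pow_le_pow_left₀ (norm_nonneg _) ?_ 2
  rw [Real.norm_eq_abs, abs_le]
  exact ⟨le_max_left _ _, max_le (by linarith) (min_le_left _ _)⟩

theorem clamp_eq_self {R : ℝ} {x : EuclideanSpace ℝ (Fin n)} (hx : ‖x‖ ≤ R) : clamp R x = x := by
  ext i
  have := (PiLp.norm_apply_le x i).trans hx
  rw [Real.norm_eq_abs, abs_le] at this
  simp [clamp, this.1, this.2]

/-- Precomposing with the 1-Lipschitz clamp turns local into global data: the clamp takes values in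
a compact ball and fixes the ball of radius `R`. -/
theorem exists_bounded_lipschitz_eqOn
    {g : EuclideanSpace ℝ (Fin n) → EuclideanSpace ℝ (Fin n)} (hg : LocallyLipschitz g)
    {R : ℝ} (hR : 0 ≤ R) :
    ∃ (h : EuclideanSpace ℝ (Fin n) → EuclideanSpace ℝ (Fin n)) (K B : ℝ≥0),
      LipschitzWith K h ∧ (∀ x, ‖h x‖ ≤ B) ∧ ∀ x, ‖x‖ ≤ R → h x = g x := by
  obtain ⟨K, hK⟩ := exists_lipschitzOnWith_closedBall hg (√(n * R ^ 2))
  obtain ⟨B, hB⟩ := (isCompact_closedBall (0 : EuclideanSpace ℝ (Fin n))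
    (√(n * R ^ 2))).exists_bound_of_continuousOn hg.continuous.continuousOn
  have hmem : ∀ x : EuclideanSpace ℝ (Fin n), clamp R x ∈ Metric.closedBall 0 (√(n * R ^ 2)) :=
    fun x => by simpa using norm_clamp_le hR x
  refine ⟨fun x => g (clamp R x), K * 1, B.toNNReal, ?_, fun x => ?_, fun x hx => ?_⟩
  · rw [← lipschitzOnWith_univ]
    exact hK.comp (lipschitzWith_clamp R).lipschitzOnWith fun x _ => hmem x
  · exact (hB _ (hmem x)).trans (Real.le_coe_toNNReal B)
  · simp only [clamp_eq_self hx]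

theorem hasDerivWithinAt_comp_lieDeriv {V : EuclideanSpace ℝ (Fin n) → ℝ}
    (hV : ContDiff ℝ 1 V) (g : EuclideanSpace ℝ (Fin n) → EuclideanSpace ℝ (Fin n))
    {x : ℝ → EuclideanSpace ℝ (Fin n)} {s : Set ℝ} {t : ℝ}
    (hx : HasDerivWithinAt x (g (x t)) s t) :
    HasDerivWithinAt (fun u => V (x u)) (lieDeriv g V (x t)) s t := by
  have h := (hV.differentiable one_ne_zero (x t)).hasGradientAt.hasFDerivAt
  have := h.comp_hasDerivWithinAt t hx
  simpa [lieDeriv] using! this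

end Fields

theorem IsClassKInfty.exists_norm_lt {E : Type*} [NormedAddCommGroup E] {α : ℝ≥0 → ℝ≥0}
    (hα : IsClassKInfty α) (M : ℝ) : ∃ R : ℝ, 0 ≤ R ∧ ∀ x : E, (α ‖x‖₊ : ℝ) ≤ M → ‖x‖ < R := by
  obtain ⟨R, hR⟩ := (hα.tendsto_atTop.eventually_gt_atTop M.toNNReal).exists
  refine ⟨R, R.2, fun x hx => ?_⟩
  have h1 : α ‖x‖₊ < α R := lt_of_le_of_lt (NNReal.le_toNNReal_of_coe_le hx) hR
  exact_mod_cast hα.strictMono.lt_iff_lt.1 h1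

/-! ### Solutions in the sense of right derivatives -/

/-- `x` is continuous on `[a, b]` and has right derivative `v t (x t)` at each `t ∈ [a, b)`. -/
def IsRightSolOn {E : Type*} [NormedAddCommGroup E] [NormedSpace ℝ E] (v : ℝ → E → E)
    (x : ℝ → E) (a b : ℝ) : Prop :=
  ContinuousOn x (Icc a b) ∧ ∀ t ∈ Ico a b, HasDerivWithinAt x (v t (x t)) (Ici t) t

namespace IsRightSolOn

section General

variable {E : Type*} [NormedAddCommGroup E] [NormedSpace ℝ E] {v w : ℝ → E → E}
  {x y : ℝ → E} {a b : ℝ}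

theorem mono (hx : IsRightSolOn v x a b) {c d : ℝ} (hc : a ≤ c) (hd : d ≤ b) :
    IsRightSolOn v x c d :=
  ⟨hx.1.mono (Icc_subset_Icc hc hd), fun t ht => hx.2 t (Ico_subset_Ico hc hd ht)⟩

theorem congr_field (hx : IsRightSolOn v x a b) (h : ∀ t ∈ Ico a b, v t (x t) = w t (x t)) :
    IsRightSolOn w x a b :=
  ⟨hx.1, fun t ht => h t ht ▸ hx.2 t ht⟩

theorem shift (hx : IsRightSolOn v x a b) (c : ℝ) :
    IsRightSolOn (fun t => v (t - c)) (fun t => x (t - c)) (a + c) (b + c) := by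
  refine ⟨hx.1.comp (by fun_prop) fun t ht => ⟨by linarith [ht.1], by linarith [ht.2]⟩,
    fun t ht => ?_⟩
  have h := hx.2 (t - c) ⟨by linarith [ht.1], by linarith [ht.2]⟩
  have := h.scomp t ((hasDerivWithinAt_id t (Ici t)).sub_const c)
    fun u hu => sub_le_sub_right (mem_Ici.1 hu) c
  simpa using! this

theorem exists_norm_le (hx : IsRightSolOn v x a b) : ∃ R, ∀ t ∈ Icc a b, ‖x t‖ ≤ R :=
  isCompact_Icc.exists_bound_of_continuousOn hx.1

/-- Uniqueness for vector fields which are Lipschitz on balls, uniformly in time. -/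
theorem eqOn (hv : ∀ R, ∃ K, ∀ t, LipschitzOnWith K (v t) (Metric.closedBall 0 R))
    (hx : IsRightSolOn v x a b) (hy : IsRightSolOn v y a b) (h : x a = y a) :
    EqOn x y (Icc a b) := by
  obtain ⟨R₁, h₁⟩ := hx.exists_norm_le
  obtain ⟨R₂, h₂⟩ := hy.exists_norm_le
  obtain ⟨K, hK⟩ := hv (max R₁ R₂)
  refine ODE_solution_unique_of_mem_Icc_right (s := fun _ => Metric.closedBall 0 (max R₁ R₂))
    (fun t _ => hK t) hx.1 hx.2 (fun t ht => ?_) hy.1 hy.2 (fun t ht => ?_) h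
  · simpa using Or.inl (h₁ t (Ico_subset_Icc_self ht))
  · simpa using Or.inr (h₂ t (Ico_subset_Icc_self ht))

end General

section Lyapunov

variable {n : ℕ} {g h : EuclideanSpace ℝ (Fin n) → EuclideanSpace ℝ (Fin n)}
  {V : EuclideanSpace ℝ (Fin n) → ℝ} {l a b : ℝ} {x : ℝ → EuclideanSpace ℝ (Fin n)}

theorem lyapunov_le (hV : ContDiff ℝ 1 V) (hl : ∀ x, lieDeriv g V x ≤ -l * V x)
    (hx : IsRightSolOn (fun _ => g) x a b) {t : ℝ} (ht : t ∈ Icc a b) :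
    V (x t) ≤ V (x a) * Real.exp (-l * (t - a)) := by
  rw [← gronwallBound_ε0]
  refine le_gronwallBound_of_liminf_deriv_right_le (f := fun u => V (x u))
    (hV.continuous.comp_continuousOn hx.1)
    (fun u hu r hr => (hasDerivWithinAt_comp_lieDeriv hV g (hx.2 u hu)).liminf_right_slope_le hr)
    le_rfl (fun u _ => ?_) t ht
  simpa using hl (x u)

/-- A trajectory of the modified field `h` never leaves the region where `h = g`. The decay of `V`
is known only in that region, so a strict barrier is used: when `V` touches `(V (x 0) + 1) * exp (c
* t)`, the point lies in the region and `V` grows there at rate at most `|l| < c`. The `+ 1` keeps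
the barrier positive, which makes the inequality strict. -/
theorem norm_lt_of_eqOn (hV : ContDiff ℝ 1 V) (hl : ∀ x, lieDeriv g V x ≤ -l * V x)
    (hV0 : ∀ x, 0 ≤ V x) {R T : ℝ}
    (hR : ∀ y, V y ≤ (V (x 0) + 1) * Real.exp ((|l| + 1) * T) → ‖y‖ < R)
    (hgh : ∀ y, ‖y‖ ≤ R → h y = g y)
    (hx : IsRightSolOn (fun _ => h) x 0 T) : ∀ t ∈ Icc 0 T, ‖x t‖ < R := by
  set c : ℝ := |l| + 1
  have hc : 0 < c := by positivity
  have hB : ∀ t ≤ T, (V (x 0) + 1) * Real.exp (c * t) ≤ (V (x 0) + 1) * Real.exp (c * T) := by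
    intro t ht
    have := hV0 (x 0)
    gcongr
  have key := image_le_of_deriv_right_lt_deriv_boundary (f := fun u => V (x u))
    (f' := fun u => lieDeriv h V (x u))
    (B := fun t => (V (x 0) + 1) * Real.exp (c * t))
    (B' := fun t => (V (x 0) + 1) * (Real.exp (c * t) * c))
    (hV.continuous.comp_continuousOn hx.1)
    (fun u hu => hasDerivWithinAt_comp_lieDeriv hV h (hx.2 u hu)) (by simp)
    (fun t => by simpa using! (((hasDerivAt_id t).const_mul c).exp).const_mul (V (x 0) + 1)) ?_
  · exact fun t ht => hR _ ((key ht).trans (hB t ht.2))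
  · intro t ht heq
    have hn : ‖x t‖ < R := hR _ (heq.le.trans (hB t ht.2.le))
    have h1 : lieDeriv h V (x t) = lieDeriv g V (x t) := by simp [lieDeriv, hgh _ hn.le]
    have hpos : 0 < V (x t) := by
      rw [heq]; have := hV0 (x 0); positivity
    rw [h1, ← mul_assoc, ← heq]
    have := hl (x t)
    have := neg_abs_le l
    nlinarith

end Lyapunov

end IsRightSolOn

/-! ### The flow of a single mode -/

theorem exists_hasDerivAt_of_bounded {E : Type*} [NormedAddCommGroup E] [NormedSpace ℝ E]
    [CompleteSpace E] {g : E → E} {K B : ℝ≥0} (hK : LipschitzWith K g) (hB : ∀ x, ‖g x‖ ≤ B)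
    (x : E) {T : ℝ} (hT : 0 ≤ T) :
    ∃ y : ℝ → E, y 0 = x ∧ ∀ t ∈ Icc 0 T, HasDerivAt y (g (y t)) t := by
  -- The time interval exceeds `[0, T]` on both sides so that derivatives at `0` and `T` are
  -- two-sided. A field bounded by `B` moves a point by at most `B * (T + 1)` in this time, hence
  -- the radius.
  have hpl : IsPicardLindelof (fun _ => g) (tmin := -1) (tmax := T + 1)
      ⟨0, by constructor <;> linarith⟩ x (B * (T + 1).toNNReal) 0 B K :=
    { lipschitzOnWith := fun _ _ => hK.lipschitzOnWith
      continuousOn := fun _ _ => continuousOn_const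
      norm_le := fun _ _ y _ => hB y
      mul_max_le := by
        have : max (T + 1 - 0) (0 - -1) = T + 1 := by
          rw [max_eq_left] <;> linarith
        simp only [this]
        rw [NNReal.coe_mul, Real.coe_toNNReal _ (by linarith)]
        simp }
  obtain ⟨y, hy0, hy⟩ := hpl.exists_eq_forall_mem_Icc_hasDerivWithinAt₀
  refine ⟨y, hy0, fun t ht => (hy t ⟨by linarith [ht.1], by linarith [ht.2]⟩).hasDerivAt ?_⟩
  exact Icc_mem_nhds (by linarith [ht.1]) (by linarith [ht.2])

section Flow

variable {n : ℕ} {g : EuclideanSpace ℝ (Fin n) → EuclideanSpace ℝ (Fin n)}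
  {V : EuclideanSpace ℝ (Fin n) → ℝ} {α : ℝ≥0 → ℝ≥0} {l : ℝ}

theorem exists_hasDerivAt_of_lyapunov (hg : LocallyLipschitz g) (hα : IsClassKInfty α)
    (hV : ContDiff ℝ 1 V) (hVα : ∀ x, (α ‖x‖₊ : ℝ) ≤ V x)
    (hl : ∀ x, lieDeriv g V x ≤ -l * V x) (x : EuclideanSpace ℝ (Fin n)) {T : ℝ} (hT : 0 ≤ T) :
    ∃ y : ℝ → EuclideanSpace ℝ (Fin n), y 0 = x ∧ ∀ t ∈ Icc 0 T, HasDerivAt y (g (y t)) t := by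
  obtain ⟨R, hR0, hR⟩ := hα.exists_norm_lt (E := EuclideanSpace ℝ (Fin n))
    ((V x + 1) * Real.exp ((|l| + 1) * T))
  obtain ⟨h, K, B, hK, hB, hgh⟩ := exists_bounded_lipschitz_eqOn hg hR0
  obtain ⟨y, hy0, hy⟩ := exists_hasDerivAt_of_bounded hK hB x hT
  have hsol : IsRightSolOn (fun _ => h) y 0 T :=
    ⟨fun t ht => (hy t ht).continuousAt.continuousWithinAt,
      fun t ht => (hy t (Ico_subset_Icc_self ht)).hasDerivWithinAt⟩
  have hlt := hsol.norm_lt_of_eqOn hV hl (fun x => (NNReal.coe_nonneg _).trans (hVα x))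
    (fun z hz => hR z ((hVα z).trans (hy0 ▸ hz))) hgh
  exact ⟨y, hy0, fun t ht => hgh _ (hlt t ht).le ▸ hy t ht⟩

/-- `φ` is the forward flow of the vector field `g`. -/
structure IsFlow (g : EuclideanSpace ℝ (Fin n) → EuclideanSpace ℝ (Fin n))
    (φ : EuclideanSpace ℝ (Fin n) → ℝ → EuclideanSpace ℝ (Fin n)) : Prop where
  zero : ∀ x, φ x 0 = x
  hasDerivAt : ∀ x, ∀ t, 0 < t → HasDerivAt (φ x) (g (φ x t)) t
  hasDerivWithinAt_zero : ∀ x, HasDerivWithinAt (φ x) (g x) (Ici 0) 0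

theorem lipschitzOnWith_const_time (hg : LocallyLipschitz g) (R : ℝ) :
    ∃ K, ∀ _ : ℝ, LipschitzOnWith K g (Metric.closedBall 0 R) :=
  (exists_lipschitzOnWith_closedBall hg R).imp fun _ h _ => h

/-- The solutions on `[0, T]` for different `T` agree by uniqueness. Evaluating the one with horizon
`t + 1` at time `t` glues them, and near a given time all of them can be compared with a single
longer solution. -/
theorem exists_isFlow (hg : LocallyLipschitz g) (hα : IsClassKInfty α)
    (hV : ContDiff ℝ 1 V) (hVα : ∀ x, (α ‖x‖₊ : ℝ) ≤ V x)
    (hl : ∀ x, lieDeriv g V x ≤ -l * V x) : ∃ φ, IsFlow g φ := by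
  choose! y hy0 hy using fun (x : EuclideanSpace ℝ (Fin n)) (T : ℝ) (hT : 0 ≤ T) =>
    exists_hasDerivAt_of_lyapunov hg hα hV hVα hl x hT
  have hsol : ∀ x T, 0 ≤ T → IsRightSolOn (fun _ => g) (y x T) 0 T := fun x T hT =>
    ⟨fun t ht => (hy x T hT t ht).continuousAt.continuousWithinAt,
      fun t ht => (hy x T hT t (Ico_subset_Icc_self ht)).hasDerivWithinAt⟩
  have heq : ∀ x T t, 0 ≤ t → t + 1 ≤ T → y x (t + 1) t = y x T t := fun x T t ht hT =>
    (hsol x (t + 1) (by linarith)).eqOn (lipschitzOnWith_const_time hg)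
      ((hsol x T (by linarith)).mono le_rfl hT)
      ((hy0 x _ (by linarith)).trans (hy0 x _ (by linarith)).symm) ⟨ht, by linarith⟩
  refine ⟨fun x t => y x (t + 1) t, fun x => hy0 x _ (by norm_num), fun x t ht => ?_, fun x => ?_⟩
  · have h := hy x (t + 2) (by linarith) t ⟨ht.le, by linarith⟩
    rw [← heq x (t + 2) t ht.le (by linarith)] at h
    refine h.congr_of_eventuallyEq ?_
    filter_upwards [Ioo_mem_nhds ht (lt_add_one t)] with u hu
    exact heq x (t + 2) u hu.1.le (by linarith [hu.2])
  · have h := (hy x 2 (by norm_num) 0 ⟨le_rfl, by norm_num⟩).hasDerivWithinAt (s := Ici 0)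
    rw [hy0 x _ (by norm_num)] at h
    refine h.congr_of_eventuallyEq ?_ (heq x 2 0 le_rfl (by norm_num))
    filter_upwards [inter_mem_nhdsWithin _ (Iio_mem_nhds (zero_lt_one' ℝ))] with u hu
    exact heq x 2 u hu.1 (by linarith [mem_Iio.1 hu.2])

namespace IsFlow

variable {φ : EuclideanSpace ℝ (Fin n) → ℝ → EuclideanSpace ℝ (Fin n)}

theorem continuousOn (hφ : IsFlow g φ) (x : EuclideanSpace ℝ (Fin n)) :
    ContinuousOn (φ x) (Ici 0) := by
  intro t ht
  rcases (mem_Ici.1 ht).eq_or_lt with rfl | ht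
  · exact (hφ.hasDerivWithinAt_zero x).continuousWithinAt
  · exact (hφ.hasDerivAt x t ht).continuousAt.continuousWithinAt

theorem isRightSolOn (hφ : IsFlow g φ) (x : EuclideanSpace ℝ (Fin n)) (T : ℝ) :
    IsRightSolOn (fun _ => g) (φ x) 0 T := by
  refine ⟨(hφ.continuousOn x).mono Icc_subset_Ici_self, fun t ht => ?_⟩
  rcases ht.1.eq_or_lt with rfl | ht
  · simpa [hφ.zero] using hφ.hasDerivWithinAt_zero x
  · exact (hφ.hasDerivAt x t ht).hasDerivWithinAt

theorem eq_of_isRightSolOn (hg : LocallyLipschitz g) (hφ : IsFlow g φ) {a b : ℝ} (hab : a ≤ b)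
    {x : ℝ → EuclideanSpace ℝ (Fin n)} (hx : IsRightSolOn (fun _ => g) x a b) :
    x b = φ (x a) (b - a) := by
  have h := ((hφ.isRightSolOn (x a) (b - a)).shift a)
  rw [zero_add, sub_add_cancel] at h
  exact hx.eqOn (lipschitzOnWith_const_time hg) h (by simp [hφ.zero]) ⟨hab, le_rfl⟩

/-- The growth bound on `V` confines all trajectories starting near `x` to one ball up to time `t`;
a single Lipschitz constant then serves in Gronwall's inequality. -/
theorem continuous_left (hg : LocallyLipschitz g) (hα : IsClassKInfty α)
    (hV : ContDiff ℝ 1 V) (hVα : ∀ x, (α ‖x‖₊ : ℝ) ≤ V x)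
    (hl : ∀ x, lieDeriv g V x ≤ -l * V x) (hφ : IsFlow g φ) {t : ℝ} (ht : 0 ≤ t) :
    Continuous fun x => φ x t := by
  rw [continuous_iff_continuousAt]
  intro x
  obtain ⟨M, hM⟩ := (isCompact_closedBall x 1).exists_bound_of_continuousOn
    hV.continuous.continuousOn
  obtain ⟨R, -, hR⟩ := hα.exists_norm_lt (E := EuclideanSpace ℝ (Fin n))
    (M * Real.exp (|l| * t))
  obtain ⟨K, hK⟩ := exists_lipschitzOnWith_closedBall hg R
  have hbd : ∀ z ∈ Metric.closedBall x 1, ∀ u ∈ Ico 0 t, φ z u ∈ Metric.closedBall 0 R := by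
    intro z hz u hu
    have h1 := (hφ.isRightSolOn z t).lyapunov_le hV hl (Ico_subset_Icc_self hu)
    rw [hφ.zero, sub_zero] at h1
    have h2 : V z ≤ M := (le_abs_self _).trans (hM z hz)
    have h3 : 0 ≤ V z := (NNReal.coe_nonneg _).trans (hVα z)
    have h4 : -l * u ≤ |l| * t :=
      (mul_le_mul_of_nonneg_right (neg_le_abs l) hu.1).trans
        (mul_le_mul_of_nonneg_left hu.2.le (abs_nonneg l))
    have h5 : V z * Real.exp (-l * u) ≤ M * Real.exp (|l| * t) := by
      have := h3.trans h2
      gcongr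
    simpa using (hR _ ((hVα _).trans (h1.trans h5))).le
  have hdist : ∀ z ∈ Metric.closedBall x 1,
      dist (φ z t) (φ x t) ≤ dist z x * Real.exp (K * (t - 0)) := fun z hz =>
    dist_le_of_trajectories_ODE_of_mem (v := fun _ => g)
      (s := fun _ => Metric.closedBall 0 R) (fun _ _ => hK)
      (hφ.isRightSolOn z t).1 (hφ.isRightSolOn z t).2 (hbd z hz)
      (hφ.isRightSolOn x t).1 (hφ.isRightSolOn x t).2
      (hbd x (Metric.mem_closedBall_self zero_le_one)) (by simp [hφ.zero]) t ⟨ht, le_rfl⟩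
  refine tendsto_iff_dist_tendsto_zero.2 (squeeze_zero' (.of_forall fun _ => dist_nonneg)
    (eventually_of_mem (Metric.closedBall_mem_nhds x one_pos) hdist) ?_)
  have : Continuous fun z => dist z x * Real.exp (K * (t - 0)) := by fun_prop
  simpa using this.tendsto x

theorem measurable_uncurry (hg : LocallyLipschitz g) (hα : IsClassKInfty α)
    (hV : ContDiff ℝ 1 V) (hVα : ∀ x, (α ‖x‖₊ : ℝ) ≤ V x)
    (hl : ∀ x, lieDeriv g V x ≤ -l * V x) (hφ : IsFlow g φ) :
    Measurable (Function.uncurry fun (t : ℝ≥0) x => φ x t) :=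
  measurable_uncurry_of_continuous_of_measurable
    (fun x => (hφ.continuousOn x).comp_continuous NNReal.continuous_coe fun t => t.2)
    fun t => (hφ.continuous_left hg hα hV hVα hl t.2).measurable

end IsFlow

end Flow

/-! ### Solutions along a fixed switching path -/

section Path

variable {n N : ℕ} {f : Fin N → EuclideanSpace ℝ (Fin n) → EuclideanSpace ℝ (Fin n)}
  {s : ℝ → Fin N} {x₀ : EuclideanSpace ℝ (Fin n)} {x : ℝ → EuclideanSpace ℝ (Fin n)}

theorem IsSubsystemFamily.exists_lipschitzOnWith (hf : IsSubsystemFamily f) (s : ℝ → Fin N)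
    (R : ℝ) : ∃ K, ∀ t, LipschitzOnWith K (f (s t)) (Metric.closedBall 0 R) := by
  choose K hK using fun i => exists_lipschitzOnWith_closedBall (hf.locallyLipschitz i) R
  exact ⟨Finset.univ.sup K, fun t => (hK (s t)).weaken (Finset.le_sup (Finset.mem_univ _))⟩

theorem IsSubsystemFamily.exists_norm_le (hf : IsSubsystemFamily f) (R : ℝ) :
    ∃ C : ℝ≥0, ∀ i, ∀ x ∈ Metric.closedBall 0 R, ‖f i x‖ ≤ C := by
  choose C hC using fun i => (isCompact_closedBall (0 : EuclideanSpace ℝ (Fin n))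
    R).exists_bound_of_continuousOn (hf.locallyLipschitz i).continuous.continuousOn
  refine ⟨Finset.univ.sup fun i => (C i).toNNReal, fun i x hx => (hC i x hx).trans ?_⟩
  exact (Real.le_coe_toNNReal _).trans (NNReal.coe_le_coe.2
    (Finset.le_sup (f := fun i => (C i).toNNReal) (Finset.mem_univ i)))

/-- A locally absolutely continuous solution has the prescribed right derivative everywhere. -/
theorem IsSolution.isRightSolOn (hf : IsSubsystemFamily f) (hs : IsCadlagPath s)
    (hx : IsSolution f s x₀ x) (T : ℝ) : IsRightSolOn (fun t => f (s t)) x 0 T := by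
  rcases lt_or_ge T 0 with hT | hT
  · exact ⟨by simp [Icc_eq_empty_of_lt hT], by simp [Ico_eq_empty_of_le hT.le]⟩
  have hac := hx.absolutelyContinuous T hT
  have hcont : ContinuousOn x (Icc 0 T) := by simpa [uIcc_of_le hT] using hac.continuousOn
  refine ⟨hcont, fun t ht => ?_⟩
  obtain ⟨c', hc', hsub'⟩ := mem_nhdsGT_iff_exists_Ioo_subset.1 (hs.1 t ht.1)
  obtain ⟨c, htc, hcT, hsub⟩ : ∃ c, t < c ∧ c ≤ T ∧ ∀ u ∈ Ioo t c, s u = s t :=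
    ⟨min c' T, lt_min hc' ht.2, min_le_right _ _,
      fun u hu => hsub' ⟨hu.1, hu.2.trans_le (min_le_left _ _)⟩⟩
  have hIcc : Icc t c ⊆ Icc 0 T := Icc_subset_Icc ht.1 hcT
  -- Right-continuity of `s` freezes the mode on `[t, c)`. Projecting time to `[t, c]` makes the
  -- integrand continuous on all of `ℝ`, so its primitive is `C¹`; `x` minus this primitive is
  -- absolutely continuous with zero derivative almost everywhere, hence constant on `[t, c]`.
  have hw : Continuous fun v => f (s t) (x (projIcc t c htc.le v)) :=
    (hf.locallyLipschitz _).continuous.comp <|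
      ContinuousOn.comp_continuous (hcont.mono hIcc) (by fun_prop) fun v => Subtype.coe_prop _
  set w : ℝ → EuclideanSpace ℝ (Fin n) := fun v => f (s t) (x (projIcc t c htc.le v)) with hw_def
  have hwx : ∀ v ∈ Icc t c, w v = f (s t) (x v) := fun v hv => by
    simp only [hw_def, projIcc_of_mem htc.le hv]
  have hJ : ∀ u, HasDerivAt (fun u => ∫ v in t..u, w v) (w u) u := fun u =>
    intervalIntegral.integral_hasDerivAt_right (hw.intervalIntegrable _ _)
      (hw.stronglyMeasurableAtFilter _ _) hw.continuousAt
  have hJac : AbsolutelyContinuousOnInterval (fun u => ∫ v in t..u, w v) t c := by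
    refine ContDiffOn.absolutelyContinuousOnInterval (ContDiff.contDiffOn ?_)
    rw [contDiff_one_iff_deriv]
    have hderiv : deriv (fun u => ∫ v in t..u, w v) = w := funext fun u => (hJ u).deriv
    exact ⟨fun u => (hJ u).differentiableAt, by rw [hderiv]; exact hw⟩
  have hxac : AbsolutelyContinuousOnInterval x t c :=
    hac.mono (by rwa [uIcc_of_le htc.le, uIcc_of_le hT])
  obtain ⟨C, hC⟩ := (hxac.sub hJac).const_of_ae_hasDerivAt_zero (by
    filter_upwards [hx.hasDerivAt, (measure_eq_zero_iff_ae_notMem.1 (measure_singleton t)),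
      (measure_eq_zero_iff_ae_notMem.1 (measure_singleton c))] with u hu hut huc humem
    rw [uIcc_of_le htc.le] at humem
    have h1 : t < u := lt_of_le_of_ne humem.1 (Ne.symm hut)
    have h2 : u < c := lt_of_le_of_ne humem.2 huc
    have := (hu (ht.1.trans_lt h1)).sub (hJ u)
    rwa [hwx u humem, hsub u ⟨h1, h2⟩, sub_self] at this)
  rw [uIcc_of_le htc.le] at hC
  have hCt : x t = C := by simpa using hC t (left_mem_Icc.2 htc.le)
  have h1 : HasDerivWithinAt (fun u => C + ∫ v in t..u, w v) (f (s t) (x t)) (Ici t) t := by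
    have := ((hJ t).const_add C).hasDerivWithinAt (s := Ici t)
    rwa [hwx t (left_mem_Icc.2 htc.le)] at this
  refine h1.congr_of_eventuallyEq ?_ (by simp [hCt])
  filter_upwards [Icc_mem_nhdsGE htc] with u hu
  have := hC u hu
  simp only [Pi.sub_apply] at this
  exact sub_eq_iff_eq_add.1 this

/-- On `[0, T]` the path is bounded, so its right derivative is bounded and the path is Lipschitz,
hence absolutely continuous. -/
theorem IsSolution.of_isRightSolOn (hf : IsSubsystemFamily f) (h0 : x 0 = x₀)
    (hx : ∀ T, IsRightSolOn (fun t => f (s t)) x 0 T)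
    (hd : ∀ᵐ t : ℝ, 0 < t → HasDerivAt x (f (s t) (x t)) t) : IsSolution f s x₀ x := by
  refine ⟨h0, fun T hT => ?_, hd⟩
  obtain ⟨R, hR⟩ := (hx T).exists_norm_le
  obtain ⟨C, hC⟩ := hf.exists_norm_le R
  refine LipschitzOnWith.absolutelyContinuousOnInterval (K := C) ?_
  rw [uIcc_of_le hT]
  refine LipschitzOnWith.of_dist_le_mul fun u hu v hv => ?_
  wlog huv : v ≤ u generalizing u v
  · rw [dist_comm (x u), dist_comm u]
    exact this v hv u hu (le_of_not_ge huv)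
  have h := (hx T).mono hv.1 hu.2
  rw [dist_eq_norm, Real.dist_eq, abs_of_nonneg (sub_nonneg.2 huv)]
  exact norm_image_sub_le_of_norm_deriv_right_le_segment h.1 h.2
    (fun t ht => hC _ _ (by simpa using hR t ⟨hv.1.trans ht.1, ht.2.le.trans hu.2⟩)) u ⟨huv, le_rfl⟩

theorem IsSolution.eqOn (hf : IsSubsystemFamily f) (hs : IsCadlagPath s)
    {y : ℝ → EuclideanSpace ℝ (Fin n)} (hx : IsSolution f s x₀ x) (hy : IsSolution f s x₀ y) :
    EqOn y x (Ici 0) := fun t ht =>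
  (hy.isRightSolOn hf hs t).eqOn (hf.exists_lipschitzOnWith s) (hx.isRightSolOn hf hs t)
    (hy.initial.trans hx.initial.symm) (right_mem_Icc.2 ht)

/-- The switching path `s` is constant between the times `0 = T 0 < T 1 < ⋯`, which tend to
infinity. -/
structure IsSwitchingPath (s : ℝ → Fin N) (T : ℕ → ℝ) : Prop where
  cadlag : IsCadlagPath s
  zero : T 0 = 0
  strictMono : StrictMono T
  tendsto : Tendsto T atTop atTop
  const : ∀ j, ∀ t ∈ Ico (T j) (T (j + 1)), s t = s (T j)

namespace IsSwitchingPath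

variable {T : ℕ → ℝ}

theorem nonneg (hT : IsSwitchingPath s T) (j : ℕ) : 0 ≤ T j :=
  hT.zero ▸ hT.strictMono.monotone (Nat.zero_le j)

theorem exists_mem_Ico (hT : IsSwitchingPath s T) {t : ℝ} (ht : 0 ≤ t) :
    ∃ j, t ∈ Ico (T j) (T (j + 1)) := by
  classical
  have h : ∃ j, t < T j := (hT.tendsto.eventually_gt_atTop t).exists
  have h0 : Nat.find h ≠ 0 := fun h0 => by
    have := Nat.find_spec h
    rw [h0, hT.zero] at this
    linarith
  obtain ⟨j, hj⟩ := Nat.exists_eq_succ_of_ne_zero h0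
  have hlt := Nat.find_spec h
  rw [hj] at hlt
  exact ⟨j, not_lt.1 (Nat.find_min h (by omega)), hlt⟩

theorem eq_of_mem_Ico (hT : IsSwitchingPath s T) {t : ℝ} {i j : ℕ}
    (hi : t ∈ Ico (T i) (T (i + 1))) (hj : t ∈ Ico (T j) (T (j + 1))) : i = j := by
  have h1 := hT.strictMono.lt_iff_lt.1 (hi.1.trans_lt hj.2)
  have h2 := hT.strictMono.lt_iff_lt.1 (hj.1.trans_lt hi.2)
  omega

theorem isRightSolOn_mode (hf : IsSubsystemFamily f) (hT : IsSwitchingPath s T)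
    (hx : IsSolution f s x₀ x) {j : ℕ} {a b : ℝ} (ha : T j ≤ a) (hb : b ≤ T (j + 1)) :
    IsRightSolOn (fun _ => f (s (T j))) x a b :=
  ((hx.isRightSolOn hf hT.cadlag b).mono ((hT.nonneg j).trans ha) le_rfl).congr_field fun t ht => by
    rw [hT.const j t ⟨ha.trans ht.1, ht.2.trans_le hb⟩]

/-- Stopping the switching times at `t` gives a recursion valid for every `j`, since the elapsed
time is zero once `T j` has passed `t`. Measurability of `x t` rests on it. -/
theorem solution_min_succ (hf : IsSubsystemFamily f) (hT : IsSwitchingPath s T)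
    {φ : Fin N → EuclideanSpace ℝ (Fin n) → ℝ → EuclideanSpace ℝ (Fin n)}
    (hφ : ∀ i, IsFlow (f i) (φ i)) (hx : IsSolution f s x₀ x) (t : ℝ) (j : ℕ) :
    x (min (T (j + 1)) t) =
      φ (s (T j)) (x (min (T j) t)) (min (T (j + 1)) t - min (T j) t) := by
  have hlt : T j < T (j + 1) := hT.strictMono (Nat.lt_succ_self j)
  rcases le_total (T j) t with h | h
  · rw [min_eq_left h]
    exact (hφ _).eq_of_isRightSolOn (hf.locallyLipschitz _) (le_min hlt.le h)
      (hT.isRightSolOn_mode hf hx le_rfl (min_le_left _ _))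
  · rw [min_eq_right h, min_eq_right (h.trans hlt.le), sub_self, (hφ _).zero]

theorem exists_isSolution (hf : IsSubsystemFamily f) (hT : IsSwitchingPath s T)
    {φ : Fin N → EuclideanSpace ℝ (Fin n) → ℝ → EuclideanSpace ℝ (Fin n)}
    (hφ : ∀ i, IsFlow (f i) (φ i)) (x₀ : EuclideanSpace ℝ (Fin n)) : ∃ x, IsSolution f s x₀ x := by
  choose! J hJ using fun (t : ℝ) (ht : 0 ≤ t) => hT.exists_mem_Ico ht
  let Y : ℕ → EuclideanSpace ℝ (Fin n) := fun j =>
    Nat.rec x₀ (fun k y => φ (s (T k)) y (T (k + 1) - T k)) j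
  let x : ℝ → EuclideanSpace ℝ (Fin n) := fun t => φ (s (T (J t))) (Y (J t)) (t - T (J t))
  have hlt : ∀ j, T j < T (j + 1) := fun j => hT.strictMono (Nat.lt_succ_self j)
  have hIco : ∀ j, ∀ t ∈ Ico (T j) (T (j + 1)), x t = φ (s (T j)) (Y j) (t - T j) := by
    intro j t ht
    have := hT.eq_of_mem_Ico (hJ t ((hT.nonneg j).trans ht.1)) ht
    simp only [x, this]
  -- The formula of piece `j` also holds at `T (j + 1)`, where piece `j + 1` starts from `Y (j +
  -- 1)`; this matching gives continuity.
  have hIcc : ∀ j, ∀ t ∈ Icc (T j) (T (j + 1)), x t = φ (s (T j)) (Y j) (t - T j) := by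
    intro j t ht
    rcases ht.2.eq_or_lt with rfl | h
    · rw [hIco (j + 1) _ ⟨le_rfl, hlt _⟩, sub_self, (hφ _).zero]
    · exact hIco j t ⟨ht.1, h⟩
  have hmode : ∀ j, IsRightSolOn (fun t => f (s t)) x (T j) (T (j + 1)) := by
    intro j
    have h := ((hφ (s (T j))).isRightSolOn (Y j) (T (j + 1) - T j)).shift (T j)
    rw [zero_add, sub_add_cancel] at h
    refine ⟨h.1.congr (hIcc j), fun t ht => ?_⟩
    simp only [hT.const j t ht, hIco j t ht]
    refine (h.2 t ht).congr_of_eventuallyEq ?_ (hIco j t ht)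
    filter_upwards [Ico_mem_nhdsGE ht.2] with u hu
    exact hIco j u ⟨ht.1.trans hu.1, hu.2⟩
  have hcont : ∀ j, ContinuousOn x (Icc 0 (T j)) := by
    intro j
    induction j with
    | zero => simp [hT.zero]
    | succ j ih =>
      rw [← Icc_union_Icc_eq_Icc (hT.nonneg j) (hlt j).le]
      exact ih.union_of_isClosed (hmode j).1 isClosed_Icc isClosed_Icc
  refine ⟨x, IsSolution.of_isRightSolOn hf ?_ (fun b => ⟨?_, fun t ht => ?_⟩) ?_⟩
  · have := hIco 0 0 ⟨hT.zero.le, hT.zero ▸ hlt 0⟩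
    rw [this, hT.zero, sub_zero, (hφ _).zero]
    rfl
  · obtain ⟨j, hj⟩ := (hT.tendsto.eventually_ge_atTop b).exists
    exact (hcont j).mono (Icc_subset_Icc le_rfl hj)
  · exact (hmode (J t)).2 t (hJ t ht.1)
  · filter_upwards [((countable_range T).ae_notMem volume)] with t ht ht0
    have hmem := hJ t ht0.le
    have hlt' : T (J t) < t := lt_of_le_of_ne hmem.1 fun h => ht ⟨_, h⟩
    have h := ((hφ (s (T (J t)))).hasDerivAt (Y (J t)) (t - T (J t)) (sub_pos.2 hlt')).scomp t
      ((hasDerivAt_id t).sub_const (T (J t)))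
    have hxt : f (s t) (x t) = f (s (T (J t))) (φ (s (T (J t))) (Y (J t)) (t - T (J t))) := by
      rw [hT.const _ t hmem]
    rw [one_smul] at h
    rw [hxt]
    refine h.congr_of_eventuallyEq ?_
    filter_upwards [Ioo_mem_nhds hlt' hmem.2] with u hu
    exact hIco _ u ⟨hu.1.le, hu.2⟩

/-! ### Growth of the Lyapunov functions along a switching path -/

section Estimate

variable {V : Fin N → EuclideanSpace ℝ (Fin n) → ℝ} {α₁ α₂ : ℝ≥0 → ℝ≥0} {μ : ℝ}
  {lam : Fin N → ℝ}

theorem lyapunov_instant_le (hf : IsSubsystemFamily f) (hV : IsLyapunovFamily f V α₁ α₂ μ lam)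
    (hT : IsSwitchingPath s T) (hx : IsSolution f s x₀ x) (j : ℕ) :
    V (s (T j)) (x (T j)) ≤ μ ^ j *
      (∏ k ∈ Finset.range j, Real.exp (-lam (s (T k)) * (T (k + 1) - T k))) * V (s 0) x₀ := by
  induction j with
  | zero => simp [hT.zero, hx.initial]
  | succ j ih =>
    have hμ : 0 < μ := zero_lt_one.trans hV.one_lt
    have h := (hT.isRightSolOn_mode hf hx le_rfl le_rfl).lyapunov_le (hV.contDiff _)
      (hV.lieDeriv_le (s (T j))) (right_mem_Icc.2 (hT.strictMono (Nat.lt_succ_self j)).le)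
    calc V (s (T (j + 1))) (x (T (j + 1))) ≤ μ * V (s (T j)) (x (T (j + 1))) := hV.le_mul _ _ _
      _ ≤ μ * ((μ ^ j * (∏ k ∈ Finset.range j,
            Real.exp (-lam (s (T k)) * (T (k + 1) - T k))) * V (s 0) x₀) *
            Real.exp (-lam (s (T j)) * (T (j + 1) - T j))) := by
          refine mul_le_mul_of_nonneg_left (h.trans ?_) hμ.le
          exact mul_le_mul_of_nonneg_right ih (Real.exp_pos _).le
      _ = _ := by rw [Finset.prod_range_succ]; ring

theorem lyapunov_le (hf : IsSubsystemFamily f) (hV : IsLyapunovFamily f V α₁ α₂ μ lam)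
    (hT : IsSwitchingPath s T) (hx : IsSolution f s x₀ x) {j : ℕ} {t : ℝ}
    (ht : t ∈ Ico (T j) (T (j + 1))) :
    (α₁ ‖x t‖₊ : ℝ) ≤ μ ^ j * (Real.exp (-lam (s (T j)) * (t - T j)) *
      ∏ k ∈ Finset.range j, Real.exp (-lam (s (T k)) * (T (k + 1) - T k))) * V (s 0) x₀ := by
  have h := (hT.isRightSolOn_mode hf hx le_rfl le_rfl).lyapunov_le (hV.contDiff _)
      (hV.lieDeriv_le (s (T j))) (Ico_subset_Icc_self ht)
  refine ((hV.lower_bound _ _).trans h).trans ((mul_le_mul_of_nonneg_right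
    (hT.lyapunov_instant_le hf hV hx j) (Real.exp_pos _).le).trans_eq ?_)
  ring

end Estimate

end IsSwitchingPath

end Path

/-! ### Exponential holding times -/

theorem lintegral_exp_expMeasure {r b : ℝ} (hr : 0 < r) (hb : b < r) :
    ∫⁻ x, ENNReal.ofReal (Real.exp (b * x)) ∂expMeasure r = ENNReal.ofReal (r / (r - b)) := by
  have hrb : 0 < r - b := sub_pos.2 hb
  have hmeas : ∀ c, Measurable (exponentialPDF c) := fun c =>
    (measurable_exponentialPDFReal c).ennreal_ofReal
  have h : expMeasure r = volume.withDensity (exponentialPDF r) := rfl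
  rw [h, lintegral_withDensity_eq_lintegral_mul _ (hmeas r) (by fun_prop)]
  -- Exponential tilting: the weight `exp (b * x)` turns the density of rate `r` into a multiple of
  -- the density of rate `r - b`.
  have : ∀ x, (exponentialPDF r * fun x => ENNReal.ofReal (Real.exp (b * x))) x =
      ENNReal.ofReal (r / (r - b)) * exponentialPDF (r - b) x := by
    intro x
    rcases lt_or_ge x 0 with hx | hx
    · simp [exponentialPDF_of_neg hx]
    · rw [Pi.mul_apply, exponentialPDF_of_nonneg hx, exponentialPDF_of_nonneg hx,
        ← ENNReal.ofReal_mul (by positivity), ← ENNReal.ofReal_mul (by positivity), mul_assoc,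
        ← Real.exp_add, ← mul_assoc, div_mul_cancel₀ _ hrb.ne']
      ring_nf
  simp_rw [this]
  rw [lintegral_const_mul _ (hmeas _), lintegral_exponentialPDF_eq_one hrb, mul_one]

theorem expMeasure_Ioi {r u : ℝ} (hr : 0 < r) (hu : 0 ≤ u) :
    expMeasure r (Ioi u) = ENNReal.ofReal (Real.exp (-(r * u))) := by
  have := isProbabilityMeasure_expMeasure hr
  have h := cdf_expMeasure_eq hr u
  rw [cdf_eq_real, if_pos hu] at h
  rw [← ofReal_measureReal, ← compl_Iic, probReal_compl_eq_one_sub measurableSet_Iic, h,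
    sub_sub_cancel]

theorem lintegral_comp_of_indepFun {Ω E F : Type*} [MeasurableSpace Ω] [MeasurableSpace E]
    [MeasurableSpace F] {P : Measure Ω} [IsFiniteMeasure P] {X : Ω → E} {Y : Ω → F}
    (h : IndepFun X Y P) (hX : Measurable X) (hY : Measurable Y) {G : E → F → ℝ≥0∞}
    (hG : Measurable (Function.uncurry G)) :
    ∫⁻ ω, G (X ω) (Y ω) ∂P = ∫⁻ y, ∫⁻ ω, G (X ω) y ∂P ∂(P.map Y) := by
  calc ∫⁻ ω, G (X ω) (Y ω) ∂P
      = ∫⁻ p, Function.uncurry G p ∂(P.map fun ω => (X ω, Y ω)) := by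
        rw [lintegral_map hG (hX.prodMk hY)]; rfl
    _ = ∫⁻ y, ∫⁻ x, G x y ∂(P.map X) ∂(P.map Y) := by
        rw [(indepFun_iff_map_prod_eq_prod_map_map hX.aemeasurable hY.aemeasurable).1 h,
          lintegral_prod_symm' _ hG]
        rfl
    _ = _ := by
        refine lintegral_congr fun y => ?_
        exact lintegral_map (f := fun x => G x y) (hG.comp measurable_prodMk_right) hX

section Holding

variable {Ω : Type*} [MeasurableSpace Ω] {P : Measure Ω} {S : ℕ → Ω → ℝ}
  {r : ℝ} {b : ℕ → ℝ}

theorem lintegral_prod_exp_holding (hr : 0 < r) (hS : ∀ i, Measurable (S i))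
    (hind : iIndepFun S P) (hlaw : ∀ i, HasLaw (S i) (expMeasure r) P) (hb : ∀ k, b k < r)
    (j : ℕ) :
    ∫⁻ ω, ∏ k ∈ Finset.range j, ENNReal.ofReal (Real.exp (b k * S k ω)) ∂P =
      ∏ k ∈ Finset.range j, ENNReal.ofReal (r / (r - b k)) := by
  rw [lintegral_prod_eq_prod_lintegral_of_indepFun (Finset.range j)
    (fun k ω => ENNReal.ofReal (Real.exp (b k * S k ω)))
    (hind.comp (fun k x => ENNReal.ofReal (Real.exp (b k * x))) fun k => by fun_prop)
    (fun k => by have := hS k; fun_prop)]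
  refine Finset.prod_congr rfl fun k _ => ?_
  rw [← lintegral_exp_expMeasure hr (hb k), ← (hlaw k).map_eq, lintegral_map (by fun_prop) (hS k)]

/-- The weight at time `t` of the event that exactly `j` switches have happened. -/
noncomputable def switchWeight (b : ℕ → ℝ) (t : ℝ) (j : ℕ) (s : ℕ → ℝ) : ℝ≥0∞ :=
  if ∑ k ∈ Finset.range j, s k ≤ t ∧ t < (∑ k ∈ Finset.range j, s k) + s j then
    ENNReal.ofReal (Real.exp (b j * (t - ∑ k ∈ Finset.range j, s k))) *
      ∏ k ∈ Finset.range j, ENNReal.ofReal (Real.exp (b k * s k))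
  else 0

theorem measurable_switchWeight {E : Type*} [MeasurableSpace E] {b : E → ℕ → ℝ} {s : E → ℕ → ℝ}
    (hb : Measurable b) (hs : Measurable s) (t : ℝ) (j : ℕ) :
    Measurable fun e => switchWeight (b e) t j (s e) := by
  have hsum : Measurable fun e => ∑ k ∈ Finset.range j, s e k := by fun_prop
  have h1 : MeasurableSet {e | ∑ k ∈ Finset.range j, s e k ≤ t} :=
    measurableSet_le hsum measurable_const
  have h2 : MeasurableSet {e | t < (∑ k ∈ Finset.range j, s e k) + s e j} :=
    measurableSet_lt measurable_const (by fun_prop)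
  exact Measurable.ite (h1.inter h2) (by fun_prop) measurable_const

/-- The holding time `S j` is independent of the earlier ones. Given that the first `j` add up to `p
≤ t`, it exceeds `t - p` with probability `exp (-r * (t - p))`, which absorbs the factor `exp (b j *
(t - p))` because `b j < r`. Only the complete holding times remain. -/
theorem lintegral_switchWeight_le [IsProbabilityMeasure P] (hr : 0 < r) (hS : ∀ i, Measurable (S i))
    (hind : iIndepFun S P) (hlaw : ∀ i, HasLaw (S i) (expMeasure r) P) (hb : ∀ k, b k < r)
    (t : ℝ) (j : ℕ) :
    ∫⁻ ω, switchWeight b t j (fun k => S k ω) ∂P ≤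
      ∏ k ∈ Finset.range j, ENNReal.ofReal (r / (r - b k)) := by
  rw [← lintegral_prod_exp_holding hr hS hind hlaw hb j]
  have hprob := isProbabilityMeasure_expMeasure hr
  let X : Ω → ℝ × ℝ≥0∞ := fun ω => (∑ k ∈ Finset.range j, S k ω,
    ∏ k ∈ Finset.range j, ENNReal.ofReal (Real.exp (b k * S k ω)))
  have hX : Measurable X := by fun_prop
  let G : ℝ → ℝ × ℝ≥0∞ → ℝ≥0∞ := fun y p =>
    if p.1 ≤ t ∧ t < p.1 + y then ENNReal.ofReal (Real.exp (b j * (t - p.1))) * p.2 else 0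
  have hG : Measurable (Function.uncurry G) := by
    have h1 : MeasurableSet {z : ℝ × ℝ × ℝ≥0∞ | z.2.1 ≤ t} :=
      measurableSet_le (by fun_prop) measurable_const
    have h2 : MeasurableSet {z : ℝ × ℝ × ℝ≥0∞ | t < z.2.1 + z.1} :=
      measurableSet_lt measurable_const (by fun_prop)
    exact Measurable.ite (h1.inter h2) (by fun_prop) measurable_const
  have hindep : IndepFun (S j) X P := by
    have h := hind.indepFun_finset {j} (Finset.range j) (by simp) hS
    exact h.comp (φ := fun z : ({j} : Finset ℕ) → ℝ => z ⟨j, by simp⟩)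
      (ψ := fun z : Finset.range j → ℝ => (∑ k : Finset.range j, z k,
        ∏ k : Finset.range j, ENNReal.ofReal (Real.exp (b k * z k))))
      (by fun_prop) (by fun_prop) |>.congr (.of_forall fun _ => rfl) (.of_forall fun ω => by
        simp only [Function.comp_apply, X]
        rw [Finset.sum_coe_sort (Finset.range j) fun k => S k ω, Finset.prod_coe_sort
          (Finset.range j) fun k => ENNReal.ofReal (Real.exp (b k * S k ω))])
  calc ∫⁻ ω, switchWeight b t j (fun k => S k ω) ∂P = ∫⁻ ω, G (S j ω) (X ω) ∂P := rfl
    _ = ∫⁻ p, ∫⁻ ω, G (S j ω) p ∂P ∂(P.map X) := lintegral_comp_of_indepFun hindep (hS j) hX hG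
    _ ≤ ∫⁻ p, p.2 ∂(P.map X) := ?_
    _ = _ := by rw [lintegral_map measurable_snd hX]
  refine lintegral_mono fun p => ?_
  have hGp : Measurable fun y => G y p := hG.comp measurable_prodMk_right
  rw [← lintegral_map hGp (hS j), (hlaw j).map_eq]
  by_cases hp : p.1 ≤ t
  · have heq : ∀ y, G y p = (Ioi (t - p.1)).indicator
        (fun _ => ENNReal.ofReal (Real.exp (b j * (t - p.1))) * p.2) y := by
      intro y
      simp only [G, hp, true_and, indicator, mem_Ioi, sub_lt_iff_lt_add']
    simp_rw [heq]
    rw [lintegral_indicator_const measurableSet_Ioi, expMeasure_Ioi hr (sub_nonneg.2 hp),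
      mul_right_comm, ← ENNReal.ofReal_mul (Real.exp_pos _).le, ← Real.exp_add]
    refine mul_le_of_le_one_left zero_le (ENNReal.ofReal_le_one.2 (Real.exp_le_one_iff.2 ?_))
    nlinarith [hb j, sub_nonneg.2 hp]
  · simp [G, hp]

/-- The expectations of `exp (-∑ S k)` form a geometric sequence of ratio `r / (r + 1)`. Their sum
is finite, so almost surely these exponentials tend to `0`. -/
theorem ae_tendsto_sum_holding (hr : 0 < r) (hS : ∀ i, Measurable (S i))
    (hind : iIndepFun S P) (hlaw : ∀ i, HasLaw (S i) (expMeasure r) P) :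
    ∀ᵐ ω ∂P, Tendsto (fun j => ∑ k ∈ Finset.range j, S k ω) atTop atTop := by
  have hq : ENNReal.ofReal (r / (r - -1)) < 1 := by
    rw [ENNReal.ofReal_lt_one, div_lt_one (by linarith)]
    linarith
  have hmeas : ∀ j, Measurable fun ω =>
      ∏ k ∈ Finset.range j, ENNReal.ofReal (Real.exp (-1 * S k ω)) := fun j => by fun_prop
  have h : ∫⁻ ω, ∑' j, ∏ k ∈ Finset.range j, ENNReal.ofReal (Real.exp (-1 * S k ω)) ∂P ≠ ∞ := by
    rw [lintegral_tsum fun j => (hmeas j).aemeasurable]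
    simp_rw [lintegral_prod_exp_holding (b := fun _ => -1) hr hS hind hlaw
      (fun _ => by linarith), Finset.prod_const, Finset.card_range]
    rw [ENNReal.tsum_geometric]
    exact ENNReal.inv_ne_top.2 (tsub_pos_of_lt hq).ne'
  filter_upwards [ae_lt_top (Measurable.tsum hmeas) h] with ω hω
  have h0 := ENNReal.tendsto_atTop_zero_of_tsum_ne_top hω.ne
  have heq : ∀ j, ∏ k ∈ Finset.range j, ENNReal.ofReal (Real.exp (-1 * S k ω)) =
      ENNReal.ofReal (Real.exp (-∑ k ∈ Finset.range j, S k ω)) := fun j => by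
    rw [← ENNReal.ofReal_prod_of_nonneg fun _ _ => (Real.exp_pos _).le, ← Real.exp_sum]
    simp
  simp_rw [heq] at h0
  have h1 : Tendsto (fun j => Real.exp (-∑ k ∈ Finset.range j, S k ω)) atTop (𝓝 0) := by
    have := (ENNReal.tendsto_toReal ENNReal.zero_ne_top).comp h0
    simpa [Function.comp_def, ENNReal.toReal_ofReal (Real.exp_pos _).le] using this
  exact tendsto_neg_atBot_iff.1 (Real.tendsto_exp_comp_nhds_zero.1 h1)

end Holding

/-! ### The modes -/

section Modes

variable {Ω : Type*} [MeasurableSpace Ω] {P : Measure Ω} [IsProbabilityMeasure P] {N : ℕ}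
  {M : ℕ → Ω → Fin N} {q : Fin N → ℝ}

/-- A constant conditional probability makes `{Y = i}` independent of `m`, with probability `q i`,
so the expectation factors over each value of `Y`. -/
theorem lintegral_mul_comp_of_condExp_const {Ω : Type*} {m mΩ : MeasurableSpace Ω} (hm : m ≤ mΩ)
    {P : Measure Ω} [IsProbabilityMeasure P] {N : ℕ} {Y : Ω → Fin N} (hY : Measurable Y)
    {q : Fin N → ℝ} (hcond : ∀ i, P⟦{ω | Y ω = i} | m⟧ =ᵐ[P] fun _ => q i)
    {g : Ω → ℝ≥0∞} (hg : Measurable[m] g) (c : Fin N → ℝ≥0∞) :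
    ∫⁻ ω, g ω * c (Y ω) ∂P = (∫⁻ ω, g ω ∂P) * ∑ i, ENNReal.ofReal (q i) * c i := by
  have hset : ∀ i, MeasurableSet {ω | Y ω = i} := fun i => hY (measurableSet_singleton i)
  have hinter : ∀ i, ∀ A, MeasurableSet[m] A → P.real ({ω | Y ω = i} ∩ A) = q i * P.real A := by
    intro i A hA
    have h1 := setIntegral_condExp (μ := P) hm
      ((integrable_const (1 : ℝ)).indicator (hset i)) hA
    rw [integral_congr_ae (ae_restrict_of_ae (hcond i)),
      integral_indicator_const _ (hset i), integral_const] at h1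
    simp only [smul_eq_mul, mul_one, measureReal_restrict_apply (hset i),
      measureReal_restrict_apply MeasurableSet.univ, univ_inter] at h1
    rw [← h1, mul_comm]
  have hprob : ∀ i, P.real {ω | Y ω = i} = q i := fun i => by
    simpa using hinter i univ MeasurableSet.univ
  have hsplit : ∀ ω, g ω * c (Y ω) =
      ∑ i, g ω * {ω | Y ω = i}.indicator (fun _ => c i) ω := by
    intro ω
    rw [← Finset.mul_sum]
    congr 1
    simp [indicator]
  simp_rw [hsplit]
  have hmeas : ∀ i ∈ Finset.univ, Measurable fun ω =>
      g ω * {ω | Y ω = i}.indicator (fun _ => c i) ω := fun i _ =>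
    (hg.mono hm le_rfl).mul (measurable_const.indicator (hset i))
  rw [lintegral_finsetSum _ hmeas, Finset.mul_sum]
  refine Finset.sum_congr rfl fun i _ => ?_
  rw [lintegral_mul_indicator_eq_lintegral_mul_lintegral_indicator hm (c i) (hset i) ?_ hg,
    lintegral_indicator_const (hset i), ← hprob i, ofReal_measureReal, mul_comm (c i)]
  rw [IndepSets_iff]
  rintro A B hA rfl
  have h1 := hinter i A hA
  rw [← hprob i, mul_comm, inter_comm, measureReal_def, measureReal_def, measureReal_def,
    ← ENNReal.toReal_mul] at h1
  exact (ENNReal.toReal_eq_toReal_iff' (by finiteness) (by finiteness)).1 h1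

theorem lintegral_prod_modes (hM : ∀ j, Measurable (M j)) {i₀ : Fin N} (h0 : ∀ ω, M 0 ω = i₀)
    (hcond : ∀ j, 1 ≤ j → ∀ i, P⟦{ω | M j ω = i} |
      MeasurableSpace.comap (fun ω (k : Fin j) => M k ω) inferInstance⟧ =ᵐ[P] fun _ => q i)
    (c : Fin N → ℝ≥0∞) (j : ℕ) :
    ∫⁻ ω, ∏ k ∈ Finset.range (j + 1), c (M k ω) ∂P =
      c i₀ * (∑ i, ENNReal.ofReal (q i) * c i) ^ j := by
  induction j with
  | zero => simp [h0]
  | succ j ih =>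
    have hm : MeasurableSpace.comap (fun ω (k : Fin (j + 1)) => M k ω) inferInstance ≤
        ‹MeasurableSpace Ω› := Measurable.comap_le (measurable_pi_lambda _ fun k => hM k)
    simp_rw [Finset.prod_range_succ _ (j + 1)]
    rw [lintegral_mul_comp_of_condExp_const hm (hM (j + 1)) (hcond (j + 1) (by omega)), ih,
      pow_succ, mul_assoc]
    refine Finset.measurable_prod _ fun k hk => ?_
    exact (Measurable.of_discrete (f := fun z : Fin (j + 1) → Fin N =>
      c (z ⟨k, Finset.mem_range.1 hk⟩))).comp (comap_measurable _)

/-- Conditional expectation is `0` by convention when the conditioning σ-algebra is not contained in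
the ambient one. If that happened here, `hcond` would force every `q i` to vanish. But the σ-algebra
of `M 0` is admissible, and conditioning on it would give every event `M 1 = i` probability `0`,
against total mass `1`. -/
theorem measurable_modes (hM : ∀ j, AEMeasurable (M j) P) (h0 : Measurable (M 0))
    (hcond : ∀ j, 1 ≤ j → ∀ i, P⟦{ω | M j ω = i} |
      MeasurableSpace.comap (fun ω (k : Fin j) => M k ω) inferInstance⟧ =ᵐ[P] fun _ => q i)
    (j : ℕ) : Measurable (M j) := by
  by_cases hm : MeasurableSpace.comap (fun ω (k : Fin (j + 1)) => M k ω) inferInstance ≤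
      ‹MeasurableSpace Ω›
  · have h1 : Measurable fun ω (k : Fin (j + 1)) => M k ω := measurable_iff_comap_le.2 hm
    exact (measurable_pi_apply (Fin.last j)).comp h1
  exfalso
  have hq : ∀ i, q i = 0 := by
    intro i
    have h1 := hcond (j + 1) (by omega) i
    rw [condExp_of_not_le hm] at h1
    obtain ⟨ω, hω⟩ := h1.exists
    exact hω.symm
  have hm1 : MeasurableSpace.comap (fun ω (k : Fin 1) => M k ω) inferInstance ≤
      ‹MeasurableSpace Ω› := by
    refine Measurable.comap_le (measurable_pi_lambda _ fun k => ?_)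
    rw [Subsingleton.elim k 0]
    exact h0
  have hset : ∀ i, NullMeasurableSet {ω | M 1 ω = i} P := fun i =>
    (hM 1).nullMeasurable (measurableSet_singleton i)
  have hzero : ∀ i, P {ω | M 1 ω = i} = 0 := by
    intro i
    have h1 := integral_condExp (μ := P) (f := {ω | M 1 ω = i}.indicator fun _ => (1 : ℝ)) hm1
    rw [integral_congr_ae (hcond 1 le_rfl i), integral_indicator₀ (hset i)] at h1
    simp only [hq, integral_zero, integral_const, smul_eq_mul, mul_one,
      measureReal_restrict_apply MeasurableSet.univ, univ_inter] at h1
    simpa [measureReal_eq_zero_iff] using h1.symm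
  have : P univ = 0 := by
    rw [← measure_iUnion_null_iff] at hzero
    rwa [show ⋃ i, {ω | M 1 ω = i} = univ from iUnion_eq_univ_iff.2 fun ω => ⟨M 1 ω, rfl⟩] at hzero
  simp at this

end Modes

/-! ### Randomly switched systems -/

section Random

variable {Ω : Type*} [MeasurableSpace Ω] {P : Measure Ω} {n N : ℕ}
  {f : Fin N → EuclideanSpace ℝ (Fin n) → EuclideanSpace ℝ (Fin n)}
  {V : Fin N → EuclideanSpace ℝ (Fin n) → ℝ} {α₁ α₂ : ℝ≥0 → ℝ≥0} {μ : ℝ} {lam : Fin N → ℝ}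
  {σ : ℝ → Ω → Fin N} {σ₀ : Fin N} {τ : ℕ → Ω → ℝ} {rate : ℝ} {q : Fin N → ℝ}

theorem IsSwitchingSignal.sum_holdingTime (hσ : IsSwitchingSignal P σ σ₀ τ) (ω : Ω) (j : ℕ) :
    ∑ k ∈ Finset.range j, holdingTime τ k ω = τ j ω := by
  simp only [holdingTime]
  rw [Finset.sum_range_sub (fun k => τ k ω), hσ.instant_zero, sub_zero]

theorem IsSwitchingSignal.measurable_holdingTime (hσ : IsSwitchingSignal P σ σ₀ τ) (j : ℕ) :
    Measurable (holdingTime τ j) :=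
  (hσ.measurable_instant (j + 1)).sub (hσ.measurable_instant j)

theorem IsSwitchingSignal.modeAt_zero (hσ : IsSwitchingSignal P σ σ₀ τ) (ω : Ω) :
    modeAt σ τ 0 ω = σ₀ := by
  rw [modeAt, hσ.instant_zero, hσ.initial]

theorem IsSwitchingSignal.aemeasurable_modeAt (hσ : IsSwitchingSignal P σ σ₀ τ) (j : ℕ) :
    AEMeasurable (modeAt σ τ j) P := by
  refine ⟨fun ω => σ ((τ j ω).toNNReal : ℝ) ω, hσ.measurable.comp
    ((hσ.measurable_instant j).real_toNNReal.prodMk measurable_id), ?_⟩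
  filter_upwards [hσ.strictMono] with ω hω
  have : 0 ≤ τ j ω := hσ.instant_zero ω ▸ hω.monotone (Nat.zero_le j)
  rw [modeAt, Real.coe_toNNReal _ this]

theorem IsSwitchingSignal.measurable_modeAt [IsProbabilityMeasure P]
    (hσ : IsSwitchingSignal P σ σ₀ τ) (hEH : IsClassEH P σ τ rate q) (j : ℕ) :
    Measurable (modeAt σ τ j) :=
  measurable_modes hσ.aemeasurable_modeAt
    (by simpa only [funext hσ.modeAt_zero] using measurable_const) hEH.mode_condProb j

theorem IsSwitchingSignal.ae_isSwitchingPath (hσ : IsSwitchingSignal P σ σ₀ τ)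
    (hEH : IsClassEH P σ τ rate q) :
    ∀ᵐ ω ∂P, IsSwitchingPath (fun t => σ t ω) (fun j => τ j ω) := by
  filter_upwards [hσ.strictMono, hσ.const_between, ae_tendsto_sum_holding hEH.rate_pos
    hσ.measurable_holdingTime hEH.holding_indep hEH.holding_law] with ω h1 h2 h3
  simp_rw [hσ.sum_holdingTime] at h3
  exact ⟨hσ.cadlag ω, hσ.instant_zero ω, h1, h3, h2⟩

theorem IsLyapunovFamily.exists_isFlow (hf : IsSubsystemFamily f)
    (hV : IsLyapunovFamily f V α₁ α₂ μ lam) :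
    ∃ φ : Fin N → EuclideanSpace ℝ (Fin n) → ℝ → EuclideanSpace ℝ (Fin n),
      ∀ i, IsFlow (f i) (φ i) :=
  Classical.skolem.1 fun i => SwitchedSystem.exists_isFlow (hf.locallyLipschitz i)
    hV.classKInfty_lower (hV.contDiff i) (hV.lower_bound i) (hV.lieDeriv_le i)

theorem hasUniqueGlobalSolutions (hf : IsSubsystemFamily f)
    (hV : IsLyapunovFamily f V α₁ α₂ μ lam) (hσ : IsSwitchingSignal P σ σ₀ τ)
    (hEH : IsClassEH P σ τ rate q) : HasUniqueGlobalSolutions P f σ := by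
  obtain ⟨φ, hφ⟩ := hV.exists_isFlow hf
  filter_upwards [hσ.ae_isSwitchingPath hEH] with ω hω x₀
  obtain ⟨x, hx⟩ := hω.exists_isSolution hf hφ x₀
  exact ⟨x, hx, fun y hy => hx.eqOn hf hω.cadlag hy⟩

theorem aemeasurable_solution [IsProbabilityMeasure P] (hf : IsSubsystemFamily f)
    (hV : IsLyapunovFamily f V α₁ α₂ μ lam) (hσ : IsSwitchingSignal P σ σ₀ τ)
    (hEH : IsClassEH P σ τ rate q) {x₀ : EuclideanSpace ℝ (Fin n)}
    {X : ℝ → Ω → EuclideanSpace ℝ (Fin n)}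
    (hX : ∀ᵐ ω ∂P, IsSolution f (fun t => σ t ω) x₀ fun t => X t ω) {t : ℝ} (ht : 0 ≤ t) :
    AEMeasurable (X t) P := by
  obtain ⟨φ, hφ⟩ := hV.exists_isFlow hf
  have hφm : Measurable fun p : Fin N × ℝ≥0 × EuclideanSpace ℝ (Fin n) => φ p.1 p.2.2 p.2.1 :=
    measurable_from_prod_countable_right fun i =>
      (hφ i).measurable_uncurry (hf.locallyLipschitz i) hV.classKInfty_lower (hV.contDiff i)
        (hV.lower_bound i) (hV.lieDeriv_le i)
  have hpath := hσ.ae_isSwitchingPath hEH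
  have hstep : ∀ j, AEMeasurable (fun ω => X (min (τ j ω) t) ω) P := by
    intro j
    induction j with
    | zero =>
      refine (aemeasurable_const (b := x₀)).congr ?_
      filter_upwards [hX] with ω hω
      rw [hσ.instant_zero, min_eq_left ht]
      exact hω.initial.symm
    | succ j ih =>
      have htime : Measurable fun ω => (min (τ (j + 1) ω) t - min (τ j ω) t).toNNReal := by
        have h1 := hσ.measurable_instant j
        have h2 := hσ.measurable_instant (j + 1)
        fun_prop
      refine (hφm.comp_aemeasurable ((hσ.measurable_modeAt hEH j).aemeasurable.prodMk
        (htime.aemeasurable.prodMk ih))).congr ?_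
      filter_upwards [hX, hpath] with ω hω hω'
      have h : min (τ j ω) t ≤ min (τ (j + 1) ω) t :=
        min_le_min_right t (hω'.strictMono.monotone (Nat.le_succ j))
      simp only [Function.comp_apply, modeAt, Real.coe_toNNReal _ (sub_nonneg.2 h)]
      exact (hω'.solution_min_succ hf hφ hω t j).symm
  refine aemeasurable_of_tendsto_metrizable_ae' hstep ?_
  filter_upwards [hpath] with ω hω
  refine tendsto_const_nhds.congr' ?_
  filter_upwards [hω.tendsto.eventually_ge_atTop t] with j hj
  rw [min_eq_right hj]

/-- At `β = 0` the two inequalities are (E3) and (E4); both are open conditions in `β`, so they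
persist for small `β > 0`. -/
theorem exists_decay_rate (hEH : IsClassEH P σ τ rate q) (hrate : ∀ i, 0 < lam i + rate)
    (hsum : ∑ i, μ * q i / (1 + lam i / rate) < 1) :
    ∃ β > 0, (∀ i, β - lam i < rate) ∧ μ * ∑ i, q i * (rate / (rate - (β - lam i))) < 1 := by
  have h1 : ∀ i, ∀ᶠ β : ℝ in 𝓝[>] 0, β - lam i < rate := fun i => by
    filter_upwards [Ioo_mem_nhdsGT (hrate i)] with β hβ
    linarith [hβ.2]
  have h2 : Tendsto (fun β : ℝ => μ * ∑ i, q i * (rate / (rate - (β - lam i)))) (𝓝 0)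
      (𝓝 (μ * ∑ i, q i * (rate / (rate - (0 - lam i))))) := by
    refine (tendsto_finsetSum _ fun i _ => ?_).const_mul μ
    refine (tendsto_const_nhds.div ?_ ?_).const_mul (q i)
    · exact tendsto_const_nhds.sub (tendsto_id.sub tendsto_const_nhds)
    · linarith [hrate i]
  have h3 : μ * ∑ i, q i * (rate / (rate - (0 - lam i))) < 1 := by
    refine lt_of_eq_of_lt ?_ hsum
    rw [Finset.mul_sum]
    refine Finset.sum_congr rfl fun i _ => ?_
    rw [one_add_div hEH.rate_pos.ne', div_div_eq_mul_div,
      show rate - (0 - lam i) = rate + lam i by ring]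
    ring
  obtain ⟨β, hβ, hβ1, hβ2⟩ := (eventually_mem_nhdsWithin.and ((eventually_all.2 h1).and
    ((h2.mono_left nhdsWithin_le_nhds).eventually_lt_const h3))).exists
  exact ⟨β, hβ, hβ1, hβ2⟩

/-- The random number of switches up to `t` is handled by summing over all `j`: each weight vanishes
off its own event, and the actual `j` supplies the bound. -/
theorem coe_le_tsum_switchWeight (hf : IsSubsystemFamily f)
    (hV : IsLyapunovFamily f V α₁ α₂ μ lam) (hσ : IsSwitchingSignal P σ σ₀ τ) (β : ℝ) {ω : Ω}
    (hω : IsSwitchingPath (fun t => σ t ω) (fun j => τ j ω)) {x₀ : EuclideanSpace ℝ (Fin n)}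
    {x : ℝ → EuclideanSpace ℝ (Fin n)} (hx : IsSolution f (fun t => σ t ω) x₀ x)
    {t : ℝ} (ht : 0 ≤ t) :
    (α₁ ‖x t‖₊ : ℝ≥0∞) ≤ (∑' j, ENNReal.ofReal μ ^ j *
      switchWeight (fun k => β - lam (modeAt σ τ k ω)) t j (fun k => holdingTime τ k ω)) *
      ENNReal.ofReal (Real.exp (-β * t) * α₂ ‖x₀‖₊) := by
  obtain ⟨j, hj⟩ := hω.exists_mem_Ico ht
  have hμ : 0 ≤ μ := zero_le_one.trans hV.one_lt.le
  have h1 := hω.lyapunov_le hf hV hx hj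
  have h2 : V (σ 0 ω) x₀ ≤ α₂ ‖x₀‖₊ := hV.upper_bound _ _
  have hexp : Real.exp (-lam (modeAt σ τ j ω) * (t - τ j ω)) *
      ∏ k ∈ Finset.range j, Real.exp (-lam (modeAt σ τ k ω) * holdingTime τ k ω) =
      Real.exp ((β - lam (modeAt σ τ j ω)) * (t - τ j ω)) *
      (∏ k ∈ Finset.range j, Real.exp ((β - lam (modeAt σ τ k ω)) * holdingTime τ k ω)) *
      Real.exp (-β * t) := by
    rw [← Real.exp_sum, ← Real.exp_sum, ← Real.exp_add, ← Real.exp_add, ← Real.exp_add]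
    congr 1
    simp_rw [sub_mul, Finset.sum_sub_distrib, neg_mul, Finset.sum_neg_distrib, ← Finset.mul_sum,
      hσ.sum_holdingTime]
    ring
  have h3 : (α₁ ‖x t‖₊ : ℝ) ≤ μ ^ j *
      (Real.exp ((β - lam (modeAt σ τ j ω)) * (t - τ j ω)) *
      ∏ k ∈ Finset.range j, Real.exp ((β - lam (modeAt σ τ k ω)) * holdingTime τ k ω)) *
      (Real.exp (-β * t) * α₂ ‖x₀‖₊) := by
    refine h1.trans ((mul_le_mul_of_nonneg_left h2 (by positivity)).trans_eq ?_)
    have := hexp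
    simp only [modeAt, holdingTime] at this ⊢
    rw [this]
    ring
  have hw : switchWeight (fun k => β - lam (modeAt σ τ k ω)) t j (fun k => holdingTime τ k ω) =
      ENNReal.ofReal (Real.exp ((β - lam (modeAt σ τ j ω)) * (t - τ j ω)) *
      ∏ k ∈ Finset.range j, Real.exp ((β - lam (modeAt σ τ k ω)) * holdingTime τ k ω)) := by
    have hj' : τ j ω ≤ t ∧ t < τ j ω + holdingTime τ j ω :=
      ⟨hj.1, by simpa [holdingTime] using hj.2⟩
    rw [switchWeight, hσ.sum_holdingTime, if_pos hj', ENNReal.ofReal_mul (Real.exp_pos _).le,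
      ENNReal.ofReal_prod_of_nonneg fun _ _ => (Real.exp_pos _).le]
  calc (α₁ ‖x t‖₊ : ℝ≥0∞) = ENNReal.ofReal (α₁ ‖x t‖₊ : ℝ) := (ENNReal.ofReal_coe_nnreal).symm
    _ ≤ _ := ENNReal.ofReal_le_ofReal h3
    _ = (ENNReal.ofReal μ ^ j *
      switchWeight (fun k => β - lam (modeAt σ τ k ω)) t j (fun k => holdingTime τ k ω)) *
      ENNReal.ofReal (Real.exp (-β * t) * α₂ ‖x₀‖₊) := by
        rw [hw, ENNReal.ofReal_mul (by positivity), ENNReal.ofReal_mul (by positivity),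
          ENNReal.ofReal_pow hμ]
    _ ≤ _ := by
        gcongr
        exact ENNReal.le_tsum (f := fun j => ENNReal.ofReal μ ^ j *
          switchWeight (fun k => β - lam (modeAt σ τ k ω)) t j (fun k => holdingTime τ k ω)) j

/-- Independence of holding times and modes allows the mode sequence to be frozen, so that the
exponents become deterministic. -/
theorem lintegral_switchWeight_modes_le [IsProbabilityMeasure P]
    (hσ : IsSwitchingSignal P σ σ₀ τ) (hEH : IsClassEH P σ τ rate q) {b : Fin N → ℝ}
    (hb : ∀ i, b i < rate) (t : ℝ) (j : ℕ) :
    ∫⁻ ω, switchWeight (fun k => b (modeAt σ τ k ω)) t j (fun k => holdingTime τ k ω) ∂P ≤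
      ∫⁻ ω, ∏ k ∈ Finset.range j, ENNReal.ofReal (rate / (rate - b (modeAt σ τ k ω))) ∂P := by
  have hS : Measurable fun ω k => holdingTime τ k ω :=
    measurable_pi_lambda _ hσ.measurable_holdingTime
  have hM : Measurable fun ω k => modeAt σ τ k ω :=
    measurable_pi_lambda _ (hσ.measurable_modeAt hEH)
  have hG : Measurable (Function.uncurry fun (s : ℕ → ℝ) (m : ℕ → Fin N) =>
      switchWeight (fun k => b (m k)) t j s) :=
    measurable_switchWeight (b := fun p : (ℕ → ℝ) × (ℕ → Fin N) => fun k => b (p.2 k))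
      (s := fun p => p.1) (measurable_pi_lambda _ fun k => (Measurable.of_discrete (f := b)).comp
        ((measurable_pi_apply k).comp measurable_snd)) measurable_fst t j
  rw [lintegral_comp_of_indepFun (G := fun (s : ℕ → ℝ) (m : ℕ → Fin N) =>
    switchWeight (fun k => b (m k)) t j s) hEH.indep hS hM hG]
  have hmeas : Measurable fun m : ℕ → Fin N =>
      ∏ k ∈ Finset.range j, ENNReal.ofReal (rate / (rate - b (m k))) :=
    Finset.measurable_prod _ fun k _ => (Measurable.of_discrete
      (f := fun i => ENNReal.ofReal (rate / (rate - b i)))).comp (measurable_pi_apply k)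
  rw [← lintegral_map (f := fun m : ℕ → Fin N =>
      ∏ k ∈ Finset.range j, ENNReal.ofReal (rate / (rate - b (m k)))) hmeas hM]
  exact lintegral_mono fun m => lintegral_switchWeight_le hEH.rate_pos
    hσ.measurable_holdingTime hEH.holding_indep hEH.holding_law (fun k => hb (m k)) t j

theorem exists_mean_decay [IsProbabilityMeasure P] (hf : IsSubsystemFamily f)
    (hV : IsLyapunovFamily f V α₁ α₂ μ lam) (hσ : IsSwitchingSignal P σ σ₀ τ)
    (hEH : IsClassEH P σ τ rate q) (hrate : ∀ i, 0 < lam i + rate)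
    (hsum : ∑ i, μ * q i / (1 + lam i / rate) < 1)
    {X : EuclideanSpace ℝ (Fin n) → ℝ → Ω → EuclideanSpace ℝ (Fin n)}
    (hX : IsSolutionProcess P f σ X) :
    ∃ K β : ℝ, 0 ≤ K ∧ 0 < β ∧ ∀ x₀ t, 0 ≤ t →
      ∫⁻ ω, (α₁ ‖X x₀ t ω‖₊ : ℝ≥0∞) ∂P ≤
        ENNReal.ofReal (K * (Real.exp (-β * t) * α₂ ‖x₀‖₊)) := by
  obtain ⟨β, hβ, hb, hlt⟩ := exists_decay_rate hEH hrate hsum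
  have hμ : 0 ≤ μ := zero_le_one.trans hV.one_lt.le
  set c : Fin N → ℝ := fun i => rate / (rate - (β - lam i)) with hc
  have hc0 : ∀ i, 0 ≤ c i := fun i => (div_pos hEH.rate_pos (sub_pos.2 (hb i))).le
  set K : ℝ≥0∞ := ∑' j, ENNReal.ofReal μ ^ j *
    ∫⁻ ω, ∏ k ∈ Finset.range j, ENNReal.ofReal (c (modeAt σ τ k ω)) ∂P with hK
  have hQ : ENNReal.ofReal μ * ∑ i, ENNReal.ofReal (q i) * ENNReal.ofReal (c i) < 1 := by
    simp_rw [← ENNReal.ofReal_mul (hEH.prob_mem _).1]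
    rw [← ENNReal.ofReal_sum_of_nonneg fun i _ => mul_nonneg (hEH.prob_mem i).1 (hc0 i),
      ← ENNReal.ofReal_mul hμ, ENNReal.ofReal_lt_one]
    exact hlt
  have hKtop : K ≠ ∞ := by
    -- The term `j = 0` is split off because the first mode is the deterministic `σ₀`: only from the
    -- second factor on do the products average to powers of the `q`-mean.
    rw [hK, tsum_eq_zero_add' ENNReal.summable]
    have hterm : ∀ j, ENNReal.ofReal μ ^ (j + 1) *
        ∫⁻ ω, ∏ k ∈ Finset.range (j + 1), ENNReal.ofReal (c (modeAt σ τ k ω)) ∂P =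
        ENNReal.ofReal μ * ENNReal.ofReal (c σ₀) *
          (ENNReal.ofReal μ * ∑ i, ENNReal.ofReal (q i) * ENNReal.ofReal (c i)) ^ j := by
      intro j
      rw [lintegral_prod_modes (hσ.measurable_modeAt hEH) hσ.modeAt_zero hEH.mode_condProb
        (fun i => ENNReal.ofReal (c i)) j]
      ring
    simp_rw [hterm]
    rw [ENNReal.tsum_mul_left, ENNReal.tsum_geometric]
    have : (1 - ENNReal.ofReal μ * ∑ i, ENNReal.ofReal (q i) * ENNReal.ofReal (c i))⁻¹ ≠ ∞ :=
      ENNReal.inv_ne_top.2 (tsub_pos_of_lt hQ).ne'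
    simp only [Finset.range_zero, Finset.prod_empty, lintegral_const, measure_univ]
    finiteness
  refine ⟨K.toReal, β, ENNReal.toReal_nonneg, hβ, fun x₀ t ht => ?_⟩
  have hwm : ∀ j, Measurable fun ω =>
      switchWeight (fun k => β - lam (modeAt σ τ k ω)) t j (fun k => holdingTime τ k ω) := fun j =>
    measurable_switchWeight (measurable_pi_lambda _ fun k =>
      (Measurable.of_discrete (f := fun i => β - lam i)).comp (hσ.measurable_modeAt hEH k))
      (measurable_pi_lambda _ hσ.measurable_holdingTime) t j
  calc ∫⁻ ω, (α₁ ‖X x₀ t ω‖₊ : ℝ≥0∞) ∂P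
      ≤ ∫⁻ ω, (∑' j, ENNReal.ofReal μ ^ j *
          switchWeight (fun k => β - lam (modeAt σ τ k ω)) t j (fun k => holdingTime τ k ω)) *
          ENNReal.ofReal (Real.exp (-β * t) * α₂ ‖x₀‖₊) ∂P := by
        refine lintegral_mono_ae ?_
        filter_upwards [hX x₀, hσ.ae_isSwitchingPath hEH] with ω hω hω'
        exact coe_le_tsum_switchWeight hf hV hσ β hω' hω ht
    _ = (∑' j, ENNReal.ofReal μ ^ j * ∫⁻ ω,
          switchWeight (fun k => β - lam (modeAt σ τ k ω)) t j (fun k => holdingTime τ k ω) ∂P) *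
          ENNReal.ofReal (Real.exp (-β * t) * α₂ ‖x₀‖₊) := by
        rw [lintegral_mul_const _ (Measurable.tsum fun j => (hwm j).const_mul _),
          lintegral_tsum fun j => ((hwm j).const_mul _).aemeasurable]
        simp_rw [fun j => lintegral_const_mul (μ := P) (ENNReal.ofReal μ ^ j) (hwm j)]
    _ ≤ K * ENNReal.ofReal (Real.exp (-β * t) * α₂ ‖x₀‖₊) := by
        gcongr ?_ * _
        refine ENNReal.tsum_le_tsum fun j => ?_
        refine mul_le_mul_right ?_ _
        exact lintegral_switchWeight_modes_le hσ hEH hb t j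
    _ = _ := by
        rw [ENNReal.ofReal_mul ENNReal.toReal_nonneg, ENNReal.ofReal_toReal hKtop]

theorem isGASMean [IsProbabilityMeasure P] (hf : IsSubsystemFamily f)
    (hV : IsLyapunovFamily f V α₁ α₂ μ lam) (hσ : IsSwitchingSignal P σ σ₀ τ)
    (hEH : IsClassEH P σ τ rate q) (hrate : ∀ i, 0 < lam i + rate)
    (hsum : ∑ i, μ * q i / (1 + lam i / rate) < 1)
    {X : EuclideanSpace ℝ (Fin n) → ℝ → Ω → EuclideanSpace ℝ (Fin n)}
    (hX : IsSolutionProcess P f σ X) : IsGASMean P α₁ X := by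
  obtain ⟨K, β, hK, hβ, hdecay⟩ := exists_mean_decay hf hV hσ hEH hrate hsum hX
  refine ⟨fun x₀ t ht => aemeasurable_solution hf hV hσ hEH (hX x₀) ht, fun ε hε => ?_,
    fun r ε hr hε => ?_⟩
  · have hcont : Continuous fun ρ : ℝ => K * (α₂ ρ.toNNReal : ℝ) :=
      continuous_const.mul (NNReal.continuous_coe.comp
        (hV.classKInfty_upper.continuous.comp continuous_real_toNNReal))
    have h0 : K * (α₂ (0 : ℝ).toNNReal : ℝ) < ε / 2 := by
      simp [hV.classKInfty_upper.map_zero, hε]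
    -- Aiming at `ε / 2` keeps the inequality strict after the supremum over `t`.
    obtain ⟨δ, hδ, hδ'⟩ := Metric.eventually_nhds_iff.1 (hcont.continuousAt.eventually_lt_const h0)
    refine ⟨δ, hδ, fun x₀ hx₀ => ?_⟩
    have h1 : K * (α₂ ‖x₀‖₊ : ℝ) < ε / 2 := by
      have := hδ' (y := ‖x₀‖) (by simpa using hx₀)
      rwa [norm_toNNReal] at this
    refine lt_of_le_of_lt (iSup₂_le fun t (ht : 0 ≤ t) => (hdecay x₀ t ht).trans
      (ENNReal.ofReal_le_ofReal ?_)) ((ENNReal.ofReal_lt_ofReal_iff hε).2 (half_lt_self hε))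
    refine (mul_le_mul_of_nonneg_left (mul_le_of_le_one_left (NNReal.coe_nonneg _) ?_) hK).trans
      h1.le
    exact Real.exp_le_one_iff.2 (by nlinarith)
  · have hlim : Tendsto (fun T : ℝ => K * (Real.exp (-β * T) * (α₂ r.toNNReal : ℝ))) atTop
        (𝓝 (K * (0 * (α₂ r.toNNReal : ℝ)))) := by
      refine (Tendsto.mul_const _ ?_).const_mul K
      exact Real.tendsto_exp_atBot.comp (tendsto_id.const_mul_atTop_of_neg (neg_lt_zero.2 hβ))
    rw [zero_mul, mul_zero] at hlim
    obtain ⟨T, hT, hT0⟩ := ((hlim.eventually_lt_const (half_pos hε)).and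
      (eventually_ge_atTop 0)).exists
    refine ⟨T, hT0, fun x₀ hx₀ => ?_⟩
    refine lt_of_le_of_lt (iSup₂_le fun t (ht : T ≤ t) => (hdecay x₀ t (hT0.trans ht)).trans
      (ENNReal.ofReal_le_ofReal ?_)) ((ENNReal.ofReal_lt_ofReal_iff hε).2 (half_lt_self hε))
    refine le_trans ?_ hT.le
    have h1 : (α₂ ‖x₀‖₊ : ℝ) ≤ α₂ r.toNNReal := by
      rw [← norm_toNNReal]
      exact_mod_cast hV.classKInfty_upper.strictMono.monotone (Real.toNNReal_le_toNNReal hx₀.le)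
    have h2 : -β * t ≤ -β * T := by nlinarith
    gcongr

end Random

end SwitchedSystem

theorem mainTheorem4 {Ω : Type*} [MeasurableSpace Ω] (P : Measure Ω) [IsProbabilityMeasure P]
    {n N : ℕ} (f : Fin N → EuclideanSpace ℝ (Fin n) → EuclideanSpace ℝ (Fin n))
    (hf : SwitchedSystem.IsSubsystemFamily f)
    (V : Fin N → EuclideanSpace ℝ (Fin n) → ℝ) (α₁ α₂ : ℝ≥0 → ℝ≥0) (μ : ℝ) (lam : Fin N → ℝ)
    (hV : SwitchedSystem.IsLyapunovFamily f V α₁ α₂ μ lam)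
    (σ : ℝ → Ω → Fin N) (σ₀ : Fin N) (τ : ℕ → Ω → ℝ)
    (hσ : SwitchedSystem.IsSwitchingSignal P σ σ₀ τ)
    (rate : ℝ) (q : Fin N → ℝ) (hEH : SwitchedSystem.IsClassEH P σ τ rate q)
    (hrate : ∀ i, 0 < lam i + rate)
    (hsum : ∑ i, μ * q i / (1 + lam i / rate) < 1) :
    SwitchedSystem.HasUniqueGlobalSolutions P f σ ∧
      ∀ X : EuclideanSpace ℝ (Fin n) → ℝ → Ω → EuclideanSpace ℝ (Fin n),
        SwitchedSystem.IsSolutionProcess P f σ X → SwitchedSystem.IsGASMean P α₁ X := by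
  exact ⟨SwitchedSystem.hasUniqueGlobalSolutions hf hV hσ hEH, fun X hX =>
    SwitchedSystem.isGASMean hf hV hσ hEH hrate hsum hX⟩
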